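/- **Setting.** Let $\mathcal S,\mathcal A$ be measurable spaces with finite reference measures $ds$, $da$ (for instance compact subsets of Euclidean space with Lebesgue measure, or finite sets), and let $\mathcal F=L^2(\mathcal S\times\mathcal A, ds\,da)$ with inner product $\langle f,h\rangle=\int fh\,ds\,da$. Let $(\mathcal S,\mathcal A,p,r,\gamma)$ be an MDP with $0\le\gamma<1$ and initial state distribution $\mu$. Let $f^k$ be a measurable function on $\mathcal S\times\mathcal A$, bounded above in $a$ for each $s$, for which the Bellman target $\mathcal Tf^k(s,a)=r(s,a)+\gamma\,\mathbb E_{s'\sim p(\cdot|s,a)}[\sup_{a'}f^k(s',a')]$ is well defined and lies in $\mathcal F$. Put $\delta_f=f-\mathcal Tf^k$ for $f\in\mathcal F$. For a density $\pi(a|s)$ and weights $c_t\ge 0$ with $\sum_t c_t=1$, let $d^\pi(s)$ be the density with respect to $ds$ of the state visitation distribution $\sum_t c_t\,\mathbb P_{\mu,\pi}(s_t\in\cdot)$, and $d^\pi(s,a)=d^\pi(s)\pi(a|s)$. (The choice $c_t=(1-\gamma)\gamma^t$ gives the discounted occupancy, the choice $c=(1,0,0,\dots)$ gives $d^\pi(s,a)=\mu(s)\pi(a|s)$.)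 For each policy considered below this distribution is assumed to have an essentially bounded density. Put $$J_{\rm out}(\pi,f)=\mathbb E_{(s,a)\sim d^\pi}[f(s,a)]=\int d^\pi(s)\,\pi(a|s)\,f(s,a)\,ds\,da .$$ **(I) General form.** Let $\mathcal G$ be a subset of a real normed space and $g\mapsto d_g=d_g^{\rm sample}\in L^\infty(\mathcal S\times\mathcal A)$ a map that is Fréchet differentiable within $\mathcal G$ at $g_0\in\mathcal G$, with derivative $\dot g\mapsto\nabla_gd_g[\dot g]$, such that $d_g$ is a probability density for all $g\in\mathcal G$ and $d_{g_0}\ge\varepsilon$ a.e. for some $\varepsilon>0$. Let $$J_{\rm in}(g,f)=\int d_g\,(\mathcal Tf^k-f)^2\,ds\,da,$$ and let $f^*(g)$ be a minimizer of $J_{\rm in}(g,\cdot)$ over $\mathcal F$, for each $g\in\mathcal G$. Let $\Psi$ map Q-functions in a set $\mathcal D\subseteq\mathcal F$ with $f^*(g_0)\in\mathcal D$ to policies $\pi=\Psi(f)\in L^2(\mathcal S\times\mathcal A)$, with derivative a bounded operator $D_f\pi:\mathcal F\to\mathcal F$ at each $f\in\mathcal D$, within $\mathcal D$. (It suffices that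 $\Psi$ is $L^2$-continuous and that each $\langle\varphi,\Psi(\cdot)\rangle$, $\varphi\in\mathcal F$, is Fréchet differentiable within $\mathcal D$ with derivative $\langle\varphi,D_f\pi[\cdot]\rangle$.) With $\pi=\Psi(f)$ and $(D_f\pi)^*$ the adjoint in $L^2$, put $$K_f=d^\pi+(D_f\pi)^*[\,d^\pi(s)\,f\,],\qquad w_{g,f}=\frac{K_f}{d_g}.$$ Then the following hold. 1. For $g\in\mathcal G$ near $g_0$ the minimizer $f^*(g)$ is unique. For all $g\in\mathcal G$ and $f\in\mathcal F$, $\nabla_fJ_{\rm in}(g,f)=2d_g\delta_f$. 2. At $g_0$ the second derivatives exist and are $D_f^2J_{\rm in}[h]=2d_{g_0}h$, which is boundedly invertible on $\mathcal F$, and $\partial^2_{g,f}J_{\rm in}(f)[\dot g]=2\,(\nabla_gd_g[\dot g])\,\delta_f$. Moreover $f^*$ is differentiable within $\mathcal G$ at $g_0$, with $D_gf^*=-(D_f^2J_{\rm in})^{-1}\,\partial^2_{g,f}J_{\rm in}(f^*(g_0))$. 3. For every $f\in\mathcal D$, $K_f$ is the gradient $\nabla_fJ_{\rm out}$ under the policy-gradient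 convention, that is, the gradient at $f$, within $\mathcal D$, of $f'\mapsto\int d^{\Psi(f)}(s)\,\Psi(f')\,f'\,ds\,da$, where the state distribution is held fixed. For $c=(1,0,0,\dots)$ it is the gradient of $f'\mapsto J_{\rm out}(\Psi(f'),f')$ itself. If $u=(D_f\pi)^\dagger[f]$ for the visitation-weighted pairings, meaning that $d^\pi u\in\mathcal F$ and $\int d^\pi(s)\,D_f\pi[h]\,f=\int d^\pi(s,a)\,h\,u$ for all $h\in\mathcal F$, then $$w_{g_0,f}=\frac{d^\pi\,\bigl(1+(D_f\pi)^\dagger[f]\bigr)}{d_{g_0}}\quad\text{a.e.}$$ 4. For every $f\in\mathcal D$ and every direction $\dot g$, $$-\bigl\langle K_f,(D_f^2J_{\rm in})^{-1}\partial^2_{g,f}J_{\rm in}(f)[\dot g]\bigr\rangle=-\tfrac12\int w_{g_0,f}\,\partial^2_{g,f}J_{\rm in}(f)[\dot g]\,ds\,da=-\int w_{g_0,f}\,(\nabla_gd_g[\dot g])\,\delta_f\,ds\,da .$$ 5. The function $g\mapsto J_{\rm out}(\Psi(f^*(g)),f^*(g))$ is differentiable within $\mathcal G$ at $g_0$. With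 $f=f^*(g_0)$, its derivative $\nabla_gJ_{\rm out}$ in the direction $\dot g$ equals the left-hand side of 4, and $$\nabla_gJ_{\rm out}[\dot g]=-\int w_{g_0,f}(s,a)\,\partial^2_{g,f}J_{\rm in}(s,a)[\dot g]\,ds\,da=-\int w_{g_0,f}\,(\nabla_gd_g[\dot g])\,\delta_f\,ds\,da .$$ (At the unconstrained optimum $\delta_f=0$ a.e., so the factor $\tfrac12$, which matters in 4, is immaterial here.) **(II) Linear mixing and softmax.** Let $d_m=m\,d^{\rm off}+(1-m)\,d^{\rm on}$, $m\in[0,1]$, with bounded probability densities $d^{\rm off},d^{\rm on}$ and $d_m\ge\varepsilon>0$ a.e. at the given $m$. Let $|\mathcal Tf^k|\le B$ a.e., and let $\pi_f(a|s)\propto e^{\beta f(s,a)}$ with $\beta\in\mathbb R$. Let $f^*(t)$ minimize $\int d_t(\mathcal Tf^k-f)^2$ over $f\in\mathcal F$, for each $t\in[0,1]$. Then $|f^*(m)|\le B$ a.e., and for every $f\in\mathcal F$ with $|f|\le B$ a.e.: $\pi_f$ is a policy; the softmax mapping is differentiable at $f$ in the sense of (I) with $\mathcal D=\{|f|\le B\}$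 and $D_f\pi[h]=\beta\,\pi_f\,(h-\mathbb E_{\pi_f}h)$; $(D_f\pi)^\dagger[f]=\beta A_f$ with $A_f=f-\mathbb E_{\pi_f}f$; hence $$w_{m,f}=\frac{d^\pi(s)\,\pi'(a|s)}{d_m},\qquad \pi'=\pi_f\,(1+\beta A_f);$$ and $$-\bigl\langle K_f,(D_f^2J_{\rm in})^{-1}\partial^2_{m,f}J_{\rm in}(f)\bigr\rangle=-\int\frac{d^\pi(s)\,\pi'(a|s)}{d_m}\,(d^{\rm off}-d^{\rm on})\,\delta_f\,ds\,da .$$ At $f=f^*(m)$ the derivative at $m$, within $[0,1]$, of $t\mapsto J_{\rm out}(\pi_{f^*(t)},f^*(t))$ exists and equals this last integral expression. Because $\delta_{f^*(m)}=0$ a.e., it also equals $$-\int\frac{d^\pi(s)\,\pi'(a|s)}{d_m}\,(d^{\rm on}-d^{\rm off})\,\delta_f\,ds\,da .$$ -/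

import Mathlib

open MeasureTheory ProbabilityTheory Filter Topology
open scoped ENNReal

noncomputable section

namespace BilevelRL

/-- A discounted Markov decision process with transition kernel `p`, reward `r`, discount factor
`γ` and initial state distribution `μ`. -/
structure MDP (S A : Type*) [MeasurableSpace S] [MeasurableSpace A] where
  p : Kernel (S × A) S
  markov : IsMarkovKernel p
  r : S × A → ℝ
  measurable_r : Measurable r
  γ : ℝ
  γ_nonneg : 0 ≤ γ
  γ_lt_one : γ < 1
  μ : Measure S
  prob : IsProbabilityMeasure μ

variable {S A : Type*} [MeasurableSpace S] [MeasurableSpace A]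

/-- The Hilbert space `L²(S × A)` of Q-functions, for reference measures `ds` on states and `da` on
actions. -/
abbrev QSpace (ds : Measure S) (da : Measure A) : Type _ := Lp ℝ 2 (ds.prod da)

/-- The space of essentially bounded (signed) densities on `S × A`. -/
abbrev DensitySpace (ds : Measure S) (da : Measure A) : Type _ := Lp ℝ ∞ (ds.prod da)

open Classical in
/-- The class in `L²(S × A)` of a square-integrable function (and `0` for other functions). -/
def toL2 (ds : Measure S) (da : Measure A) (φ : S × A → ℝ) : QSpace ds da :=
  if h : MemLp φ 2 (ds.prod da) then h.toLp φ else 0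

/-- `d` is a probability density on `S × A`. -/
def IsProbDensity (ds : Measure S) (da : Measure A) (d : DensitySpace ds da) : Prop :=
  (∀ᵐ x ∂(ds.prod da), 0 ≤ d x) ∧ ∫ x, d x ∂(ds.prod da) = 1

/-- `π(a | s)` is a conditional action density. -/
def IsPolicy (ds : Measure S) (da : Measure A) (π : QSpace ds da) : Prop :=
  (∀ᵐ x ∂(ds.prod da), 0 ≤ π x) ∧ ∀ᵐ s ∂ds, ∫ a, π (s, a) ∂da = 1

/-! ### Inner level -/

/-- The Bellman target `(T f)(s,a) = r(s,a) + γ E_{s'} [max_{a'} f(s',a')]`. -/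
def bellman (M : MDP S A) (f : S × A → ℝ) (x : S × A) : ℝ :=
  M.r x + M.γ * ∫ s', (⨆ a', f (s', a')) ∂(M.p x)

/-- The maximum and the expectation in `T f` make sense, and `T f` is square-integrable. -/
def HasBellmanTarget (M : MDP S A) (ds : Measure S) (da : Measure A) (f : S × A → ℝ) : Prop :=
  Measurable f ∧ (∀ s, BddAbove (Set.range fun a => f (s, a))) ∧
  (∀ᵐ x ∂(ds.prod da), Integrable (fun s' => ⨆ a', f (s', a')) (M.p x)) ∧
  MemLp (bellman M f) 2 (ds.prod da)

/-- The temporal difference error `δ_f = f - T fk`. -/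
def tdError (M : MDP S A) {ds : Measure S} {da : Measure A} (fk : S × A → ℝ) (f : QSpace ds da)
    (x : S × A) : ℝ :=
  f x - bellman M fk x

/-- The inner objective `J_in = E_{(s,a) ∼ d} [(T fk - f)²]`, for a sampling density `d`. -/
def Jin (M : MDP S A) {ds : Measure S} {da : Measure A} (fk : S × A → ℝ) (d : DensitySpace ds da)
    (f : QSpace ds da) : ℝ :=
  ∫ x, d x * (bellman M fk x - f x) ^ 2 ∂(ds.prod da)

/-- The gradient `∇_f J_in` in the Hilbert space `L²(S × A)`. -/
def gradJin (M : MDP S A) {ds : Measure S} {da : Measure A} (fk : S × A → ℝ)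
    (d : DensitySpace ds da) (f : QSpace ds da) : QSpace ds da :=
  gradient (Jin M fk d) f

/-! ### Visitation distribution and outer level -/

/-- The law of the state `s_t` when actions are drawn from `π`, starting from `s_0 ∼ μ`. -/
def stateLaw (M : MDP S A) {ds : Measure S} (da : Measure A) (π : QSpace ds da) :
    ℕ → Measure S
  | 0 => M.μ
  | t + 1 => (((stateLaw M da π t).prod da).withDensity fun x => ENNReal.ofReal (π x)).bind M.p

/-- The state visitation distribution `∑ₜ cₜ P(sₜ ∈ ·)` of `π` for time weights `c`. For
`cₜ = (1 - γ) γᵗ` it is the normalized discounted occupancy; for `c = (1, 0, 0, …)` it is the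
initial state distribution. -/
def visitMeasure (M : MDP S A) (c : ℕ → ℝ) {ds : Measure S} {da : Measure A} (π : QSpace ds da) :
    Measure S :=
  Measure.sum fun t => ENNReal.ofReal (c t) • stateLaw M da π t

/-- The density `d^π(s)` of the state visitation distribution with respect to `ds`. -/
def visitDensity (M : MDP S A) (c : ℕ → ℝ) {ds : Measure S} {da : Measure A} (π : QSpace ds da)
    (s : S) : ℝ :=
  ((visitMeasure M c π).rnDeriv ds s).toReal

/-- The visitation distribution of `π` has an essentially bounded density. -/
def HasBoundedVisitDensity (M : MDP S A) (c : ℕ → ℝ) {ds : Measure S} {da : Measure A}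
    (π : QSpace ds da) : Prop :=
  visitMeasure M c π ≪ ds ∧ ∃ C : ℝ, ∀ᵐ s ∂ds, visitDensity M c π s ≤ C

/-- `∫ ρ(s) π(a|s) f(s,a) ds da`, for a state density `ρ`. -/
def stateValue {ds : Measure S} {da : Measure A} (ρ : S → ℝ) (π f : QSpace ds da) : ℝ :=
  ∫ x, ρ x.1 * π x * f x ∂(ds.prod da)

/-- The outer objective `J_out(π, f) = E_{(s,a) ∼ d^π} [f(s,a)]` with `d^π(s,a) = d^π(s) π(a|s)`. -/
def Jout (M : MDP S A) (c : ℕ → ℝ) {ds : Measure S} {da : Measure A} (π f : QSpace ds da) : ℝ :=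
  stateValue (visitDensity M c π) π f

/-- `L` is the derivative `D_f π` at `f`, within `𝒟`, of the policy mapping `Ψ`: the mapping is
continuous and each scalar function `⟪φ, Ψ ·⟫` has Fréchet derivative `⟪φ, L ·⟫`. Every mapping that
is Fréchet differentiable in `L²` has this property. The softmax mapping, in general
not Fréchet differentiable in the norm of `L²`, has it on sets of uniformly bounded functions. -/
def HasPolicyDerivWithinAt {ds : Measure S} {da : Measure A} (Ψ : QSpace ds da → QSpace ds da)
    (L : QSpace ds da →L[ℝ] QSpace ds da) (𝒟 : Set (QSpace ds da)) (f : QSpace ds da) : Prop :=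
  ContinuousWithinAt Ψ 𝒟 f ∧
  ∀ φ : QSpace ds da,
    HasFDerivWithinAt (fun f' => inner ℝ φ (Ψ f')) ((innerSL ℝ φ).comp L) 𝒟 f

section
variable {ds : Measure S} {da : Measure A} [IsFiniteMeasure ds] [IsFiniteMeasure da]

/-- `∇_f J_out = d^π + (D_f π)† [d^π(s) f]`, with `L = D_f π` and `†` the adjoint in `L²(S × A)`;
`ρ` is the state density `d^π(s)`. -/
def gradJout (ρ : S → ℝ) (π : QSpace ds da) (L : QSpace ds da →L[ℝ] QSpace ds da)
    (f : QSpace ds da) : QSpace ds da :=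
  toL2 ds da (fun x => ρ x.1 * π x) +
    ContinuousLinearMap.adjoint L (toL2 ds da fun x => ρ x.1 * f x)

/-- The density ratio `w = (d^π + (D_f π)† [d^π(s) f]) / d`. -/
def weight (ρ : S → ℝ) (π : QSpace ds da) (L : QSpace ds da →L[ℝ] QSpace ds da)
    (f : QSpace ds da) (d : DensitySpace ds da) (x : S × A) : ℝ :=
  gradJout ρ π L f x / d x

end

/-- `u = L† [φ]` for the visitation-weighted pairings: `∫ d^π(s) η φ` for a variation `η = L h` of
the policy, and `∫ d^π(s,a) h u` for Q-functions. -/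
def IsVisitAdjoint {ds : Measure S} {da : Measure A} (ρ : S → ℝ) (π : QSpace ds da)
    (L : QSpace ds da →L[ℝ] QSpace ds da) (φ : QSpace ds da) (u : S × A → ℝ) : Prop :=
  MemLp (fun x => ρ x.1 * π x * u x) 2 (ds.prod da) ∧
  ∀ h : QSpace ds da, ∫ x, ρ x.1 * L h x * φ x ∂(ds.prod da) =
    ∫ x, ρ x.1 * π x * h x * u x ∂(ds.prod da)

/-! ### Softmax policies and linear mixing -/

/-- The softmax policy `π(a|s) ∝ exp(β f(s,a))`. -/
def softmax {ds : Measure S} {da : Measure A} (β : ℝ) (f : QSpace ds da) : QSpace ds da :=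
  toL2 ds da fun x => Real.exp (β * f x) / ∫ a, Real.exp (β * f (x.1, a)) ∂da

/-- `E_{a ∼ π(·|s)} [h(s,a)]`. -/
def actionMean {ds : Measure S} {da : Measure A} (π h : QSpace ds da) (s : S) : ℝ :=
  ∫ a, π (s, a) * h (s, a) ∂da

/-- The advantage `A_f(s,a) = f(s,a) - E_{a ∼ π(·|s)} [f(s,a)]`. -/
def advantage {ds : Measure S} {da : Measure A} (π f : QSpace ds da) (x : S × A) : ℝ :=
  f x - actionMean π f x.1

/-- The tilted policy `π'(a|s) = π(a|s) (1 + β A_f(s,a))` of the softmax policy `π` of `f`. -/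
def tiltedPolicy {ds : Measure S} {da : Measure A} (β : ℝ) (f : QSpace ds da) (x : S × A) : ℝ :=
  softmax β f x * (1 + β * advantage (softmax β f) f x)

/-- The mixture `d_m = m d^off + (1 - m) d^on`. -/
def linearMix {ds : Measure S} {da : Measure A} (doff don : DensitySpace ds da) (m : ℝ) :
    DensitySpace ds da :=
  m • doff + (1 - m) • don

/-- The Q-functions that are essentially bounded by `B`. -/
def boundedQ (ds : Measure S) (da : Measure A) (B : ℝ) : Set (QSpace ds da) :=
  {f | ∀ᵐ x ∂(ds.prod da), |f x| ≤ B}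

end BilevelRL

end

open BilevelRL

open BilevelRL

/-!
The sampling density enters the inner problem only through the quadratic form
`Jin d f = ⟪d (f - τ), f - τ⟫`, where `τ` is the class in `L²` of the Bellman target. Multiplication
of an `L²` function by an `L∞` function is a bounded bilinear map (`mulL2`), so `gradJin_eq`
identifies `∇_f J_in` with `2 d (f - τ)`, which is affine in `f` and linear in `d`; both second
derivatives are read off from this formula, and a density bounded away from zero makes `2 d` an
invertible multiplication operator (`exists_two_mulL2_equiv`). A density close in `L∞` to one that
is bounded away from zero is bounded away from zero too, hence near `g₀` the only minimizer is `τ`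
(`eventually_eq_bellmanL2_of_isMinOn`). The inner solution is therefore locally constant, the mixed
second derivative vanishes there because `δ_τ = 0`, and implicit differentiation, as well as every
formula for the derivative of the outer objective, reduces to `0 = 0`.

The identities at an arbitrary `f` do not degenerate in this way. With the state density held fixed,
the outer objective is `⟪d^π(s) f, Ψ f⟫`, and `hasFDerivWithinAt_inner_clm_policy` is the product
rule for such a pairing when `Ψ` is only weakly differentiable. Passing the policy derivative to its
adjoint gives `gradJout`, and dividing by `2 d` gives the density ratio
(`inner_gradJout_eq_integral_weight`).

For the softmax policy, a bounded perturbation of the logits changes the policy by `β π (h - E_π h)`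
up to a remainder bounded pointwise by `C (h² + ∫ h² da)`; this is the second-order expansion
`abs_tilt_remainder_le` of a tilted probability density. On uniformly bounded Q-functions the
remainder is thus `O(‖h‖)` in `L²` and `O(‖h‖²)` in `L¹`. Against a bounded test function it is
`O(‖h‖²)`, and bounded functions are dense in `L²`, so it is `o(‖h‖)` against every test function.
Finally, integration over the actions is symmetric for weights that depend on the state alone
(`inner_mulL2_actionIntegral`), which makes the softmax derivative self-adjoint for the
visitation-weighted pairing and yields the advantage.
-/

/-! ### Multiplication operators on `L²` -/

section Multiplication

variable {α : Type*} [MeasurableSpace α] {ν : Measure α}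

/-- Multiplication of an `L²` function by an `L∞` function, as a bounded bilinear map. -/
noncomputable def mulL2 (ν : Measure α) : Lp ℝ ∞ ν →L[ℝ] Lp ℝ 2 ν →L[ℝ] Lp ℝ 2 ν :=
  (ContinuousLinearMap.mul ℝ ℝ).holderL ν ∞ 2 2

lemma coeFn_mulL2 (d : Lp ℝ ∞ ν) (h : Lp ℝ 2 ν) : mulL2 ν d h =ᵐ[ν] fun x => d x * h x :=
  ContinuousLinearMap.coeFn_holder (r := 2) (ContinuousLinearMap.mul ℝ ℝ) d h

lemma Lp_two_inner_eq_integral (f g : Lp ℝ 2 ν) : inner ℝ f g = ∫ x, f x * g x ∂ν := by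
  simp [L2.inner_def, mul_comm]

lemma inner_mulL2 (d : Lp ℝ ∞ ν) (f g : Lp ℝ 2 ν) :
    inner ℝ (mulL2 ν d f) g = ∫ x, d x * f x * g x ∂ν := by
  rw [Lp_two_inner_eq_integral]
  refine integral_congr_ae ?_
  filter_upwards [coeFn_mulL2 d f] with x hx
  rw [hx]

lemma inner_mulL2_comm (d : Lp ℝ ∞ ν) (f g : Lp ℝ 2 ν) :
    inner ℝ (mulL2 ν d f) g = inner ℝ f (mulL2 ν d g) := by
  rw [inner_mulL2, real_inner_comm, inner_mulL2]
  exact integral_congr_ae (.of_forall fun x => by ring)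

lemma mulL2_comm (d e : Lp ℝ ∞ ν) (h : Lp ℝ 2 ν) :
    mulL2 ν d (mulL2 ν e h) = mulL2 ν e (mulL2 ν d h) := by
  refine Lp.ext ?_
  filter_upwards [coeFn_mulL2 d (mulL2 ν e h), coeFn_mulL2 e (mulL2 ν d h), coeFn_mulL2 d h,
    coeFn_mulL2 e h] with x h1 h2 h3 h4
  rw [h1, h2, h3, h4]
  ring

lemma ae_abs_le_norm_Lp_top (d : Lp ℝ ∞ ν) : ∀ᵐ x ∂ν, |d x| ≤ ‖d‖ := by
  have h := ae_le_eLpNormEssSup (f := d) (μ := ν)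
  filter_upwards [h] with x hx
  rw [Lp.norm_def, eLpNorm_exponent_top, ← Real.norm_eq_abs, ← toReal_enorm]
  refine ENNReal.toReal_mono ?_ hx
  simpa [eLpNorm_exponent_top] using Lp.eLpNorm_ne_top d

lemma exists_Lp_top_inv (d : Lp ℝ ∞ ν) (hd : ∃ ε > 0, ∀ᵐ x ∂ν, ε ≤ d x) :
    ∃ e : Lp ℝ ∞ ν, e =ᵐ[ν] fun x => (d x)⁻¹ := by
  obtain ⟨ε, hε, hd⟩ := hd
  have hm : MemLp (fun x => (d x)⁻¹) ∞ ν := by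
    refine memLp_top_of_bound (Lp.aestronglyMeasurable d).aemeasurable.inv.aestronglyMeasurable
      ε⁻¹ ?_
    filter_upwards [hd] with x hx
    rw [norm_inv, Real.norm_of_nonneg (hε.le.trans hx)]
    exact inv_anti₀ hε hx
  exact ⟨hm.toLp _, hm.coeFn_toLp⟩

/-- Multiplication by `2 d`, for a density `d` bounded away from zero, is an isomorphism of `L²`. -/
lemma exists_two_mulL2_equiv (d : Lp ℝ ∞ ν) (hd : ∃ ε > 0, ∀ᵐ x ∂ν, ε ≤ d x) :
    ∃ H : Lp ℝ 2 ν ≃L[ℝ] Lp ℝ 2 ν,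
      (H : Lp ℝ 2 ν →L[ℝ] Lp ℝ 2 ν) = (2 : ℝ) • mulL2 ν d ∧
      (∀ h, H h =ᵐ[ν] fun x => 2 * d x * h x) ∧
      ∀ h, H.symm h =ᵐ[ν] fun x => h x / (2 * d x) := by
  obtain ⟨e, he⟩ := exists_Lp_top_inv d hd
  obtain ⟨ε, hε, hd⟩ := hd
  have h1 : ∀ h, ((2 : ℝ) • mulL2 ν d) h =ᵐ[ν] fun x => 2 * d x * h x := fun h => by
    filter_upwards [Lp.coeFn_smul (2 : ℝ) (mulL2 ν d h), coeFn_mulL2 d h] with x hx hx'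
    rw [_root_.smul_apply, hx, Pi.smul_apply, hx', smul_eq_mul, mul_assoc]
  have h2 : ∀ h, ((1 / 2 : ℝ) • mulL2 ν e) h =ᵐ[ν] fun x => h x / (2 * d x) := fun h => by
    filter_upwards [Lp.coeFn_smul (1 / 2 : ℝ) (mulL2 ν e h), coeFn_mulL2 e h, he, hd]
      with x hx hx' hx'' hx3
    have : d x ≠ 0 := (hε.trans_le hx3).ne'
    rw [_root_.smul_apply, hx, Pi.smul_apply, hx', smul_eq_mul, hx'']
    field_simp
  refine ⟨ContinuousLinearEquiv.equivOfInverse ((2 : ℝ) • mulL2 ν d) ((1 / 2 : ℝ) • mulL2 ν e)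
    (fun h => Lp.ext ?_) (fun h => Lp.ext ?_), rfl, h1, h2⟩
  · filter_upwards [h2 (((2 : ℝ) • mulL2 ν d) h), h1 h, hd] with x hx hx' hx3
    have : d x ≠ 0 := (hε.trans_le hx3).ne'
    rw [hx, hx']
    field_simp
  · filter_upwards [h1 (((1 / 2 : ℝ) • mulL2 ν e) h), h2 h, hd] with x hx hx' hx3
    have : d x ≠ 0 := (hε.trans_le hx3).ne'
    rw [hx, hx']
    field_simp

lemma hasFDerivAt_inner_mulL2_sub (d : Lp ℝ ∞ ν) (τ f : Lp ℝ 2 ν) :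
    HasFDerivAt (fun f => inner ℝ (mulL2 ν d (f - τ)) (f - τ))
      (innerSL ℝ ((2 : ℝ) • mulL2 ν d (f - τ))) f := by
  have h1 : HasFDerivAt (fun f => f - τ) (ContinuousLinearMap.id ℝ (Lp ℝ 2 ν)) f :=
    (hasFDerivAt_id f).sub_const τ
  have h2 := ((mulL2 ν d).hasFDerivAt.comp f h1).inner ℝ h1
  refine h2.congr_fderiv ?_
  ext h
  simp only [fderivInnerCLM_apply, ContinuousLinearMap.comp_apply,
    ContinuousLinearMap.prod_apply, ContinuousLinearMap.id_apply, innerSL_apply_apply,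
    Function.comp, real_inner_smul_left]
  rw [inner_mulL2_comm d h, real_inner_comm _ h]
  ring

/-- A density near one that is bounded away from zero is itself bounded away from zero. -/
lemma eventually_exists_pos_le {ι : Type*} {l : Filter ι} {d : ι → Lp ℝ ∞ ν} {d₀ : Lp ℝ ∞ ν}
    (hd₀ : ∃ ε > 0, ∀ᵐ x ∂ν, ε ≤ d₀ x) (h : Tendsto d l (𝓝 d₀)) :
    ∀ᶠ i in l, ∃ ε > 0, ∀ᵐ x ∂ν, ε ≤ d i x := by
  obtain ⟨ε, hε, hd₀⟩ := hd₀
  filter_upwards [h (Metric.ball_mem_nhds d₀ (half_pos hε))] with i hi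
  refine ⟨ε / 2, half_pos hε, ?_⟩
  rw [Set.mem_preimage, Metric.mem_ball, dist_eq_norm] at hi
  filter_upwards [hd₀, ae_abs_le_norm_Lp_top (d i - d₀), Lp.coeFn_sub (d i) d₀] with x h1 h2 h3
  rw [h3, Pi.sub_apply] at h2
  have := (abs_le.1 (h2.trans hi.le)).1
  linarith

end Multiplication

/-! ### Weak differentiability from a dense set of test functions -/

section Weak

/-- For a remainder `R` that is `O(‖y - x‖)` in norm, it suffices to check `⟪φ, R y⟫ = o(‖y - x‖)`
for `φ` in a dense set. -/
lemma isLittleO_inner_of_dense {E H : Type*} [NormedAddCommGroup E] [NormedAddCommGroup H]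
    [InnerProductSpace ℝ H] {l : Filter E} {x : E} {R : E → H} {C : ℝ} {T : Set H} (hT : Dense T)
    (hR : ∀ᶠ y in l, ‖R y‖ ≤ C * ‖y - x‖)
    (h : ∀ φ ∈ T, (fun y => inner ℝ φ (R y)) =o[l] fun y => y - x) (φ : H) :
    (fun y => inner ℝ φ (R y)) =o[l] fun y => y - x := by
  have hR' : ∀ᶠ y in l, ‖R y‖ ≤ (|C| + 1) * ‖y - x‖ := hR.mono fun y hy =>
    hy.trans (mul_le_mul_of_nonneg_right ((le_abs_self C).trans (by linarith)) (norm_nonneg _))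
  have hC : 0 < |C| + 1 := by positivity
  refine Asymptotics.isLittleO_iff.2 fun η hη => ?_
  obtain ⟨ψ, hψ, hφψ⟩ := Metric.dense_iff.1 hT φ (η / 2 / (|C| + 1)) (by positivity)
  rw [Metric.mem_ball, dist_comm, dist_eq_norm] at hψ
  filter_upwards [hR', Asymptotics.isLittleO_iff.1 (h ψ hφψ) (half_pos hη)] with y h1 h2
  have h3 : inner ℝ φ (R y) = inner ℝ (φ - ψ) (R y) + inner ℝ ψ (R y) := by
    rw [inner_sub_left]; ring
  have h4 : ‖inner ℝ (φ - ψ) (R y)‖ ≤ η / 2 * ‖y - x‖ := calc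
    _ ≤ ‖φ - ψ‖ * ‖R y‖ := norm_inner_le_norm _ _
    _ ≤ η / 2 / (|C| + 1) * ((|C| + 1) * ‖y - x‖) := by gcongr
    _ = η / 2 * ‖y - x‖ := by field_simp
  rw [h3]
  refine (norm_add_le _ _).trans ?_
  linarith

/-- The bounded functions in `L²` contain the simple functions, hence are dense. -/
lemma dense_Lp_two_ae_bounded {α : Type*} [MeasurableSpace α] (ν : Measure α) :
    Dense {φ : Lp ℝ 2 ν | ∃ N : ℝ, ∀ᵐ x ∂ν, |φ x| ≤ N} := by
  refine (Lp.simpleFunc.denseRange (E := ℝ) (μ := ν) (p := 2) (by simp)).mono ?_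
  rintro _ ⟨φ, rfl⟩
  obtain ⟨N, hN⟩ := (Lp.simpleFunc.toSimpleFunc φ).exists_forall_norm_le
  refine ⟨N, ?_⟩
  filter_upwards [Lp.simpleFunc.toSimpleFunc_eq_toFun φ] with x hx
  rw [← Real.norm_eq_abs]
  exact hx ▸ hN x

end Weak

/-! ### The inner problem -/

section Inner

variable {S A : Type*} [MeasurableSpace S] [MeasurableSpace A] {ds : Measure S} {da : Measure A}

lemma coeFn_toL2 {φ : S × A → ℝ} (h : MemLp φ 2 (ds.prod da)) :
    toL2 ds da φ =ᵐ[ds.prod da] φ := by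
  rw [toL2, dif_pos h]
  exact h.coeFn_toLp

lemma toL2_eq_of_ae_eq {φ : S × A → ℝ} {f : QSpace ds da} (h : f =ᵐ[ds.prod da] φ) :
    toL2 ds da φ = f :=
  Lp.ext ((coeFn_toL2 ((memLp_congr_ae h).1 (Lp.memLp f))).trans h.symm)

/-- The class in `L²` of the Bellman target. -/
noncomputable def bellmanL2 (M : MDP S A) (ds : Measure S) (da : Measure A) (fk : S × A → ℝ) :
    QSpace ds da :=
  toL2 ds da (bellman M fk)

variable {M : MDP S A} {fk : S × A → ℝ}

lemma coeFn_bellmanL2 (hfk : HasBellmanTarget M ds da fk) :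
    bellmanL2 M ds da fk =ᵐ[ds.prod da] bellman M fk :=
  coeFn_toL2 hfk.2.2.2

lemma coeFn_sub_bellmanL2 (hfk : HasBellmanTarget M ds da fk) (f : QSpace ds da) :
    ⇑(f - bellmanL2 M ds da fk) =ᵐ[ds.prod da] tdError M fk f := by
  filter_upwards [Lp.coeFn_sub f (bellmanL2 M ds da fk), coeFn_bellmanL2 hfk] with x h1 h2
  rw [h1, Pi.sub_apply, h2, tdError]

lemma tdError_bellmanL2_ae_eq_zero (hfk : HasBellmanTarget M ds da fk) :
    tdError M fk (bellmanL2 M ds da fk) =ᵐ[ds.prod da] 0 := by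
  filter_upwards [coeFn_bellmanL2 hfk] with x h2
  simp [tdError, h2]

/-- The inner objective is a quadratic form in the distance to the Bellman target. -/
lemma Jin_eq_inner (hfk : HasBellmanTarget M ds da fk) (d : DensitySpace ds da)
    (f : QSpace ds da) :
    Jin M fk d f = inner ℝ (mulL2 _ d (f - bellmanL2 M ds da fk)) (f - bellmanL2 M ds da fk) := by
  rw [inner_mulL2, Jin]
  refine integral_congr_ae ?_
  filter_upwards [coeFn_sub_bellmanL2 hfk f] with x hx
  rw [hx, tdError]
  ring

lemma hasFDerivAt_Jin (hfk : HasBellmanTarget M ds da fk) (d : DensitySpace ds da)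
    (f : QSpace ds da) :
    HasFDerivAt (Jin M fk d)
      (innerSL ℝ ((2 : ℝ) • mulL2 _ d (f - bellmanL2 M ds da fk))) f := by
  rw [funext (Jin_eq_inner hfk d)]
  exact hasFDerivAt_inner_mulL2_sub d _ f

lemma gradJin_eq (hfk : HasBellmanTarget M ds da fk) (d : DensitySpace ds da)
    (f : QSpace ds da) :
    gradJin M fk d f = (2 : ℝ) • mulL2 _ d (f - bellmanL2 M ds da fk) :=
  HasGradientAt.gradient (hasGradientAt_iff_hasFDerivAt.2 (hasFDerivAt_Jin hfk d f))

lemma coeFn_two_mulL2_sub_bellmanL2 (hfk : HasBellmanTarget M ds da fk) (d : DensitySpace ds da)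
    (f : QSpace ds da) :
    ⇑((2 : ℝ) • mulL2 _ d (f - bellmanL2 M ds da fk)) =ᵐ[ds.prod da]
      fun x => 2 * d x * tdError M fk f x := by
  filter_upwards [Lp.coeFn_smul (2 : ℝ) (mulL2 _ d (f - bellmanL2 M ds da fk)),
    coeFn_mulL2 d (f - bellmanL2 M ds da fk), coeFn_sub_bellmanL2 hfk f] with x h1 h2 h3
  rw [h1, Pi.smul_apply, h2, h3, smul_eq_mul, mul_assoc]

lemma Jin_bellmanL2 (hfk : HasBellmanTarget M ds da fk) (d : DensitySpace ds da) :
    Jin M fk d (bellmanL2 M ds da fk) = 0 := by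
  simp [Jin_eq_inner hfk]

lemma Jin_nonneg {d : DensitySpace ds da} (hd : ∀ᵐ x ∂(ds.prod da), 0 ≤ d x)
    (f : QSpace ds da) : 0 ≤ Jin M fk d f := by
  refine integral_nonneg_of_ae ?_
  filter_upwards [hd] with x hx
  exact mul_nonneg hx (sq_nonneg _)

lemma isMinOn_Jin_bellmanL2 (hfk : HasBellmanTarget M ds da fk) {d : DensitySpace ds da}
    (hd : ∀ᵐ x ∂(ds.prod da), 0 ≤ d x) :
    IsMinOn (Jin M fk d) Set.univ (bellmanL2 M ds da fk) := fun f _ => by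
  simpa [Jin_bellmanL2 hfk] using Jin_nonneg hd f

/-- If the sampling density is bounded away from zero, the inner problem has no minimizer other
than the Bellman target. -/
lemma eq_bellmanL2_of_isMinOn_Jin (hfk : HasBellmanTarget M ds da fk) {d : DensitySpace ds da}
    (hd : ∃ ε > 0, ∀ᵐ x ∂(ds.prod da), ε ≤ d x) {f : QSpace ds da}
    (hf : IsMinOn (Jin M fk d) Set.univ f) : f = bellmanL2 M ds da fk := by
  obtain ⟨ε, hε, hd⟩ := hd
  set τ := bellmanL2 M ds da fk
  have h0 : Jin M fk d f ≤ 0 := (hf (Set.mem_univ τ)).trans_eq (Jin_bellmanL2 hfk d)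
  -- the quadratic form `Jin` is coercive with constant `ε`
  have hε' : ε * ‖f - τ‖ ^ 2 ≤ Jin M fk d f := by
    rw [Jin_eq_inner hfk, ← real_inner_self_eq_norm_sq, ← real_inner_smul_left,
      Lp_two_inner_eq_integral, Lp_two_inner_eq_integral]
    refine integral_mono_ae ?_ ?_ ?_
    · simpa [mul_comm] using L2.integrable_inner (𝕜 := ℝ) (ε • (f - τ)) (f - τ)
    · simpa [mul_comm] using L2.integrable_inner (𝕜 := ℝ) (mulL2 _ d (f - τ)) (f - τ)
    · filter_upwards [hd, Lp.coeFn_smul ε (f - τ), coeFn_mulL2 d (f - τ)] with x h1 h2 h3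
      change _ ≤ mulL2 _ d (f - τ) x * (f - τ) x
      simp only [h2, h3, Pi.smul_apply, smul_eq_mul, mul_assoc]
      exact mul_le_mul_of_nonneg_right h1 (mul_self_nonneg _)
  have h1 : ‖f - τ‖ ^ 2 ≤ 0 := by
    by_contra! h
    nlinarith
  exact sub_eq_zero.1 (norm_eq_zero.1 (pow_eq_zero_iff two_ne_zero |>.1
    (le_antisymm h1 (sq_nonneg _))))

/-- Near a density bounded away from zero, the solution of the inner problem does not depend on
the sampling density. -/
lemma eventually_eq_bellmanL2_of_isMinOn (hfk : HasBellmanTarget M ds da fk) {G : Type*}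
    [TopologicalSpace G] {𝒢 : Set G} {g₀ : G} {d : G → DensitySpace ds da}
    (hd : ContinuousWithinAt d 𝒢 g₀) (hd₀ : ∃ ε > 0, ∀ᵐ x ∂(ds.prod da), ε ≤ d g₀ x)
    {fstar : G → QSpace ds da}
    (hmin : ∀ g ∈ 𝒢, IsMinOn (Jin M fk (d g)) Set.univ (fstar g)) :
    ∀ᶠ g in 𝓝[𝒢] g₀, fstar g = bellmanL2 M ds da fk := by
  filter_upwards [eventually_exists_pos_le hd₀ hd, self_mem_nhdsWithin] with g hg hg'
  exact eq_bellmanL2_of_isMinOn_Jin hfk hg (hmin g hg')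

end Inner

/-! ### The outer objective -/

section Outer

variable {S A : Type*} [MeasurableSpace S] [MeasurableSpace A] {ds : Measure S} {da : Measure A}

lemma exists_Lp_top_visitDensity [IsFiniteMeasure ds] [IsFiniteMeasure da] {M : MDP S A}
    {c : ℕ → ℝ} {π : QSpace ds da} (h : HasBoundedVisitDensity M c π) :
    ∃ r : DensitySpace ds da, r =ᵐ[ds.prod da] fun x => visitDensity M c π x.1 := by
  obtain ⟨-, C, hC⟩ := h
  have hm : MemLp (fun x : S × A => visitDensity M c π x.1) ∞ (ds.prod da) := by
    refine memLp_top_of_bound ?_ C ?_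
    · exact ((Measure.measurable_rnDeriv _ _).ennreal_toReal.comp
        measurable_fst).aestronglyMeasurable
    · filter_upwards [Measure.quasiMeasurePreserving_fst.ae hC] with x hx
      rwa [visitDensity, Real.norm_of_nonneg ENNReal.toReal_nonneg]
  exact ⟨hm.toLp _, hm.coeFn_toLp⟩

/-- When all the weight is on time `0`, the visitation distribution is the initial state
distribution, whatever the policy. -/
lemma visitMeasure_single_zero (M : MDP S A) (π : QSpace ds da) :
    visitMeasure M (Pi.single 0 1) π = M.μ := by
  ext s hs
  rw [visitMeasure, Measure.sum_apply _ hs, tsum_eq_single 0]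
  · simp [stateLaw]
  · intro t ht
    simp [ht]

variable {ρ : S → ℝ} {r : DensitySpace ds da}

lemma coeFn_mulL2_of_ae_eq (hr : r =ᵐ[ds.prod da] fun x => ρ x.1) (f : QSpace ds da) :
    mulL2 _ r f =ᵐ[ds.prod da] fun x => ρ x.1 * f x := by
  filter_upwards [coeFn_mulL2 r f, hr] with x h1 h2
  rw [h1, h2]

lemma stateValue_eq_inner (hr : r =ᵐ[ds.prod da] fun x => ρ x.1) (π f : QSpace ds da) :
    stateValue ρ π f = inner ℝ (mulL2 _ r f) π := by
  rw [inner_mulL2, stateValue]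
  refine integral_congr_ae ?_
  filter_upwards [hr] with x h
  rw [h]
  ring

/-- Product rule for `f ↦ ⟪m f, Ψ f⟫`, with `m` linear, where `Ψ` has only a weak derivative: the
remainder `⟪m (f' - f), Ψ f' - Ψ f⟫` is negligible because `Ψ` is continuous. -/
lemma hasFDerivWithinAt_inner_clm_policy {Ψ : QSpace ds da → QSpace ds da}
    {L : QSpace ds da →L[ℝ] QSpace ds da} {𝒟 : Set (QSpace ds da)} {f : QSpace ds da}
    (hΨ : HasPolicyDerivWithinAt Ψ L 𝒟 f) (m : QSpace ds da →L[ℝ] QSpace ds da) :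
    HasFDerivWithinAt (fun f' => inner ℝ (m f') (Ψ f'))
      ((innerSL ℝ (m f)).comp L + (innerSL ℝ (Ψ f)).comp m) 𝒟 f := by
  have h1 := hΨ.2 (m f)
  have h2 : HasFDerivWithinAt (fun f' => innerSL ℝ (Ψ f) (m (f' - f)))
      ((innerSL ℝ (Ψ f)).comp m) 𝒟 f :=
    (((innerSL ℝ (Ψ f)).comp m).hasFDerivAt.comp f
      ((hasFDerivAt_id f).sub_const f)).hasFDerivWithinAt
  have h3 : HasFDerivWithinAt (fun f' => inner ℝ (m (f' - f)) (Ψ f' - Ψ f))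
      (0 : QSpace ds da →L[ℝ] ℝ) 𝒟 f := by
    refine .of_isLittleO ?_
    simp only [sub_self, map_zero, inner_zero_right, sub_zero, _root_.zero_apply]
    refine Asymptotics.IsLittleO.of_norm_left ?_
    have ha : (fun f' => ‖m (f' - f)‖ * ‖Ψ f' - Ψ f‖) =o[𝓝[𝒟] f] fun f' => ‖f' - f‖ * (1 : ℝ) := by
      refine Asymptotics.IsBigO.mul_isLittleO ?_ ?_
      · exact (m.isBigO_comp (fun f' => f' - f) _).norm_norm
      · rw [Asymptotics.isLittleO_one_iff]
        have := (hΨ.1.sub (continuousWithinAt_const (b := Ψ f))).norm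
        simpa [ContinuousWithinAt] using this
    simp only [mul_one] at ha
    refine (Asymptotics.IsBigO.trans_isLittleO ?_ ha).of_norm_right
    refine Asymptotics.IsBigO.of_bound 1 (.of_forall fun f' => ?_)
    rw [one_mul, norm_norm, norm_mul, norm_norm, norm_norm]
    exact norm_inner_le_norm _ _
  refine (((h1.add h2).add h3).congr_fderiv (add_zero _)).congr_of_eventuallyEq
    (.of_forall fun f' => ?_) ?_
  · simp only [Pi.add_apply, innerSL_apply_apply, map_sub, inner_sub_left, inner_sub_right,
      real_inner_comm (Ψ f)]
    ring
  · simp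

lemma gradJout_eq (hr : r =ᵐ[ds.prod da] fun x => ρ x.1) (π : QSpace ds da)
    (L : QSpace ds da →L[ℝ] QSpace ds da) (f : QSpace ds da) :
    gradJout ρ π L f = mulL2 _ r π + ContinuousLinearMap.adjoint L (mulL2 _ r f) := by
  rw [gradJout, toL2_eq_of_ae_eq (coeFn_mulL2_of_ae_eq hr π),
    toL2_eq_of_ae_eq (coeFn_mulL2_of_ae_eq hr f)]

lemma hasFDerivWithinAt_stateValue (hr : r =ᵐ[ds.prod da] fun x => ρ x.1)
    {Ψ : QSpace ds da → QSpace ds da} {L : QSpace ds da →L[ℝ] QSpace ds da}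
    {𝒟 : Set (QSpace ds da)} {f : QSpace ds da} (hΨ : HasPolicyDerivWithinAt Ψ L 𝒟 f) :
    HasFDerivWithinAt (fun f' => stateValue ρ (Ψ f') f')
      (innerSL ℝ (gradJout ρ (Ψ f) L f)) 𝒟 f := by
  rw [funext fun f' => stateValue_eq_inner hr (Ψ f') f']
  refine (hasFDerivWithinAt_inner_clm_policy hΨ (mulL2 _ r)).congr_fderiv ?_
  ext h
  simp only [_root_.add_apply, ContinuousLinearMap.comp_apply, innerSL_apply_apply,
    gradJout_eq hr, inner_add_left, ContinuousLinearMap.adjoint_inner_left, inner_mulL2_comm]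
  ring

lemma hasFDerivWithinAt_Jout_single_zero [IsFiniteMeasure ds] [IsFiniteMeasure da]
    {M : MDP S A} {Ψ : QSpace ds da → QSpace ds da} {L : QSpace ds da →L[ℝ] QSpace ds da}
    {𝒟 : Set (QSpace ds da)} {f : QSpace ds da} (hΨ : HasPolicyDerivWithinAt Ψ L 𝒟 f)
    (hb : HasBoundedVisitDensity M (Pi.single 0 1) (Ψ f)) :
    HasFDerivWithinAt (fun f' => Jout M (Pi.single 0 1) (Ψ f') f')
      (innerSL ℝ (gradJout (visitDensity M (Pi.single 0 1) (Ψ f)) (Ψ f) L f)) 𝒟 f := by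
  obtain ⟨r, hr⟩ := exists_Lp_top_visitDensity hb
  have h : ∀ f', visitDensity M (Pi.single 0 1) (Ψ f') = visitDensity M (Pi.single 0 1) (Ψ f) :=
    fun f' => by
      ext s
      simp only [visitDensity, visitMeasure_single_zero]
  simp only [Jout, h]
  exact hasFDerivWithinAt_stateValue hr hΨ

/-- If `u` is the visitation-weighted adjoint `(D_f π)† [f]`, then the `L²` adjoint sends `d^π(s) f`
to `d^π(s) π u`, so that `d^π(s) π` factors out of the density ratio. -/
lemma weight_ae_eq_of_isVisitAdjoint (hr : r =ᵐ[ds.prod da] fun x => ρ x.1) {π f : QSpace ds da}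
    {L : QSpace ds da →L[ℝ] QSpace ds da} {u : S × A → ℝ} (hu : IsVisitAdjoint ρ π L f u)
    (d : DensitySpace ds da) :
    weight ρ π L f d =ᵐ[ds.prod da] fun x => ρ x.1 * π x * (1 + u x) / d x := by
  have hadj : ContinuousLinearMap.adjoint L (mulL2 _ r f) =
      toL2 ds da (fun x => ρ x.1 * π x * u x) := by
    refine ext_inner_right ℝ fun h => ?_
    rw [ContinuousLinearMap.adjoint_inner_left, inner_mulL2, Lp_two_inner_eq_integral]
    calc ∫ x, r x * f x * L h x ∂(ds.prod da)
        = ∫ x, ρ x.1 * L h x * f x ∂(ds.prod da) := by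
          refine integral_congr_ae ?_
          filter_upwards [hr] with x hx
          rw [hx]
          ring
      _ = ∫ x, ρ x.1 * π x * h x * u x ∂(ds.prod da) := hu.2 h
      _ = _ := by
          refine integral_congr_ae ?_
          filter_upwards [coeFn_toL2 hu.1] with x hx
          rw [hx]
          ring
  have hK := Lp.coeFn_add (mulL2 _ r π) (ContinuousLinearMap.adjoint L (mulL2 _ r f))
  filter_upwards [hK, coeFn_mulL2_of_ae_eq hr π, coeFn_toL2 hu.1] with x h1 h2 h3
  rw [weight, gradJout_eq hr, h1, Pi.add_apply, h2, hadj, h3]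
  ring

/-- The inverse of the second derivative of the inner objective turns `⟪K, ·⟫` into integration
against the density ratio. -/
lemma inner_gradJout_eq_integral_weight {d : DensitySpace ds da} {y z : QSpace ds da}
    (hz : z =ᵐ[ds.prod da] fun x => y x / (2 * d x)) (ρ : S → ℝ) (π : QSpace ds da)
    (L : QSpace ds da →L[ℝ] QSpace ds da) (f : QSpace ds da) :
    inner ℝ (gradJout ρ π L f) z = (1 / 2) * ∫ x, weight ρ π L f d x * y x ∂(ds.prod da) := by
  rw [Lp_two_inner_eq_integral, ← integral_const_mul]
  refine integral_congr_ae ?_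
  filter_upwards [hz] with x hx
  rw [hx, weight]
  field_simp

lemma inner_gradJout_eq_integral_weight_tdError {M : MDP S A} {fk : S × A → ℝ}
    {d d' : DensitySpace ds da} {f y z : QSpace ds da}
    (hz : z =ᵐ[ds.prod da] fun x => y x / (2 * d x))
    (hy : y =ᵐ[ds.prod da] fun x => 2 * d' x * tdError M fk f x) (ρ : S → ℝ) (π : QSpace ds da)
    (L : QSpace ds da →L[ℝ] QSpace ds da) :
    inner ℝ (gradJout ρ π L f) z =
      ∫ x, weight ρ π L f d x * d' x * tdError M fk f x ∂(ds.prod da) := by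
  rw [inner_gradJout_eq_integral_weight hz, ← integral_const_mul]
  refine integral_congr_ae ?_
  filter_upwards [hy] with x hx
  rw [hx]
  ring

end Outer

/-! ### Second derivatives of the inner objective -/

section SecondDerivative

variable {S A : Type*} [MeasurableSpace S] [MeasurableSpace A] {ds : Measure S} {da : Measure A}
  {M : MDP S A} {fk : S × A → ℝ}

/-- The mixed second derivative of the inner objective. -/
lemma hasFDerivWithinAt_gradJin (hfk : HasBellmanTarget M ds da fk) {G : Type*}
    [NormedAddCommGroup G] [NormedSpace ℝ G] {𝒢 : Set G} {d : G → DensitySpace ds da} {g₀ : G}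
    {d' : G →L[ℝ] DensitySpace ds da} (hd : HasFDerivWithinAt d d' 𝒢 g₀) (f : QSpace ds da) :
    HasFDerivWithinAt (fun g => gradJin M fk (d g) f)
      ((2 : ℝ) • ((mulL2 _).flip (f - bellmanL2 M ds da fk)).comp d') 𝒢 g₀ := by
  rw [funext fun g => gradJin_eq hfk (d g) f]
  have h := (((mulL2 (ds.prod da)).flip (f - bellmanL2 M ds da fk)).hasFDerivAt
    (x := d g₀)).comp_hasFDerivWithinAt g₀ hd
  exact h.const_smul (2 : ℝ)

lemma hasFDerivAt_gradJin (hfk : HasBellmanTarget M ds da fk) (d : DensitySpace ds da)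
    (f : QSpace ds da) :
    HasFDerivAt (gradJin M fk d) ((2 : ℝ) • mulL2 _ d) f := by
  rw [funext (gradJin_eq hfk d)]
  exact ((mulL2 _ d).hasFDerivAt.comp f ((hasFDerivAt_id f).sub_const _)).const_smul (2 : ℝ)

end SecondDerivative

/-! ### Integration over actions -/

section ActionIntegral

lemma sq_integral_le_measure_mul_integral_sq {α : Type*} [MeasurableSpace α] {ν : Measure α}
    [IsFiniteMeasure ν] {f : α → ℝ} (hf : MemLp f 2 ν) :
    (∫ x, f x ∂ν) ^ 2 ≤ ν.real Set.univ * ∫ x, f x ^ 2 ∂ν := by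
  set V := ν.real Set.univ
  set I := ∫ x, f x ∂ν
  have hf1 : Integrable f ν := hf.integrable one_le_two
  have hf2 : Integrable (fun x => f x ^ 2) ν := hf.integrable_sq
  -- the variance `∫ (V f - I)²` is nonnegative
  have h : 0 ≤ ∫ x, (V * f x - I) ^ 2 ∂ν := integral_nonneg fun x => sq_nonneg _
  have h' : ∫ x, (V * f x - I) ^ 2 ∂ν = V * (V * ∫ x, f x ^ 2 ∂ν - I ^ 2) := by
    have : ∀ x, (V * f x - I) ^ 2 = V ^ 2 * f x ^ 2 - 2 * V * I * f x + I ^ 2 := fun x => by ring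
    simp only [this]
    have e1 := integral_sub (hf2.const_mul (V ^ 2)) (hf1.const_mul (2 * V * I))
    have e2 := integral_add ((hf2.const_mul (V ^ 2)).sub (hf1.const_mul (2 * V * I)))
      (integrable_const (I ^ 2))
    simp only [Pi.sub_apply] at e2
    rw [e2, e1, integral_const_mul, integral_const_mul, integral_const, smul_eq_mul]
    change V ^ 2 * _ - 2 * V * I * I + V * I ^ 2 = _
    ring
  rw [h'] at h
  rcases (measureReal_nonneg : 0 ≤ V).eq_or_lt with hV | hV
  · have hν : ν = 0 := by
      rw [← Measure.measure_univ_eq_zero]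
      exact (measureReal_eq_zero_iff).1 hV.symm
    simp [I, hν]
  · exact sub_nonneg.1 (nonneg_of_mul_nonneg_right h hV)

variable {S A : Type*} [MeasurableSpace S] [MeasurableSpace A] {ds : Measure S} {da : Measure A}
  [IsFiniteMeasure da]

lemma ae_ae_fst_of_ae_prod {p : S × A → Prop} (h : ∀ᵐ z ∂(ds.prod da), p z) :
    ∀ᵐ x ∂(ds.prod da), ∀ᵐ a ∂da, p (x.1, a) :=
  Measure.quasiMeasurePreserving_fst.ae (Measure.ae_ae_of_ae_prod h)

lemma integrable_fiber_integral_sq (h : QSpace ds da) :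
    Integrable (fun x : S × A => ∫ a, h (x.1, a) ^ 2 ∂da) (ds.prod da) :=
  ((Lp.memLp h).integrable_sq.integral_prod_left).comp_fst da

lemma stronglyMeasurable_actionIntegral (h : QSpace ds da) :
    StronglyMeasurable fun x : S × A => ∫ a, h (x.1, a) ∂da :=
  (StronglyMeasurable.integral_prod_right (f := fun s a => h (s, a))
    (Lp.stronglyMeasurable h)).comp_measurable measurable_fst

variable [IsFiniteMeasure ds]

lemma ae_memLp_two_fiber (h : QSpace ds da) :
    ∀ᵐ s ∂ds, MemLp (fun a => h (s, a)) 2 da := by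
  have h2 := (Lp.memLp h).integrable_sq
  filter_upwards [h2.prod_right_ae] with s hs
  exact (memLp_two_iff_integrable_sq
    ((Lp.stronglyMeasurable h).comp_measurable measurable_prodMk_left).aestronglyMeasurable).2 hs

lemma integral_fiber_integral_sq (h : QSpace ds da) :
    ∫ x, (∫ a, h (x.1, a) ^ 2 ∂da) ∂(ds.prod da) = da.real Set.univ * ‖h‖ ^ 2 := by
  rw [← real_inner_self_eq_norm_sq, Lp_two_inner_eq_integral,
    integral_fun_fst (fun s => ∫ a, h (s, a) ^ 2 ∂da), smul_eq_mul]
  have := integral_prod _ (Lp.memLp h).integrable_sq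
  rw [← this]
  simp only [sq]

lemma ae_sq_actionIntegral_le (h : QSpace ds da) :
    ∀ᵐ x ∂(ds.prod da), (∫ a, h (x.1, a) ∂da) ^ 2 ≤
      da.real Set.univ * ∫ a, h (x.1, a) ^ 2 ∂da :=
  Measure.quasiMeasurePreserving_fst.ae
    ((ae_memLp_two_fiber h).mono fun _ hs => sq_integral_le_measure_mul_integral_sq hs)

lemma memLp_actionIntegral (h : QSpace ds da) :
    MemLp (fun x : S × A => ∫ a, h (x.1, a) ∂da) 2 (ds.prod da) := by
  rw [memLp_two_iff_integrable_sq (stronglyMeasurable_actionIntegral h).aestronglyMeasurable]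
  refine ((integrable_fiber_integral_sq h).const_mul (da.real Set.univ)).mono'
    ((stronglyMeasurable_actionIntegral h).pow 2).aestronglyMeasurable ?_
  filter_upwards [ae_sq_actionIntegral_le h] with x hx
  rwa [Real.norm_of_nonneg (sq_nonneg _)]

/-- The operator `h ↦ ∫ h(s,a') da'` of integration over the actions, with values in functions on
`S × A` that depend on the state alone. -/
noncomputable def actionIntegral (ds : Measure S) (da : Measure A) [IsFiniteMeasure ds]
    [IsFiniteMeasure da] : QSpace ds da →L[ℝ] QSpace ds da :=
  LinearMap.mkContinuous
    { toFun := fun h => toL2 ds da fun x => ∫ a, h (x.1, a) ∂da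
      map_add' := fun h k => by
        refine toL2_eq_of_ae_eq ?_
        filter_upwards [Lp.coeFn_add (toL2 ds da fun x => ∫ a, h (x.1, a) ∂da)
            (toL2 ds da fun x => ∫ a, k (x.1, a) ∂da), coeFn_toL2 (memLp_actionIntegral h),
          coeFn_toL2 (memLp_actionIntegral k), ae_ae_fst_of_ae_prod (Lp.coeFn_add h k),
          Measure.quasiMeasurePreserving_fst.ae (ae_memLp_two_fiber h),
          Measure.quasiMeasurePreserving_fst.ae (ae_memLp_two_fiber k)] with x h1 h2 h3 h4 h5 h6
        rw [h1, Pi.add_apply, h2, h3, integral_congr_ae h4]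
        exact (integral_add (h5.integrable one_le_two) (h6.integrable one_le_two)).symm
      map_smul' := fun t h => by
        refine toL2_eq_of_ae_eq ?_
        filter_upwards [Lp.coeFn_smul t (toL2 ds da fun x => ∫ a, h (x.1, a) ∂da),
          coeFn_toL2 (memLp_actionIntegral h), ae_ae_fst_of_ae_prod (Lp.coeFn_smul t h)]
          with x h1 h2 h4
        rw [RingHom.id_apply, h1, Pi.smul_apply, h2, integral_congr_ae h4]
        exact (integral_const_mul t _).symm }
    (da.real Set.univ) fun h => by
      have h0 : (0 : ℝ) ≤ da.real Set.univ := measureReal_nonneg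
      refine le_of_sq_le_sq ?_ (by positivity)
      rw [mul_pow, sq (da.real _), mul_assoc, ← integral_fiber_integral_sq h,
        ← real_inner_self_eq_norm_sq, Lp_two_inner_eq_integral, ← integral_const_mul]
      refine integral_mono_ae ?_ ((integrable_fiber_integral_sq h).const_mul _) ?_
      · simpa [sq] using (Lp.memLp (toL2 ds da fun x => ∫ a, h (x.1, a) ∂da)).integrable_sq
      · filter_upwards [ae_sq_actionIntegral_le h, coeFn_toL2 (memLp_actionIntegral h)]
          with x h1 h2
        simp only [LinearMap.coe_mk, AddHom.coe_mk, h2]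
        rwa [← sq]

lemma coeFn_actionIntegral (h : QSpace ds da) :
    actionIntegral ds da h =ᵐ[ds.prod da] fun x => ∫ a, h (x.1, a) ∂da :=
  coeFn_toL2 (memLp_actionIntegral h)

/-- Integration over the actions is symmetric with respect to any weight depending on the state
alone: both sides are `∫ ρ(s) (∫ h da) (∫ k da) ds`. -/
lemma inner_mulL2_actionIntegral {ρ : S → ℝ} {r : DensitySpace ds da}
    (hr : r =ᵐ[ds.prod da] fun x => ρ x.1) (h k : QSpace ds da) :
    inner ℝ (mulL2 _ r (actionIntegral ds da h)) k =
      inner ℝ (mulL2 _ r h) (actionIntegral ds da k) := by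
  have key : ∀ h k : QSpace ds da, inner ℝ (mulL2 _ r (actionIntegral ds da h)) k =
      ∫ s, ρ s * (∫ a, h (s, a) ∂da) * (∫ a, k (s, a) ∂da) ∂ds := fun h k => by
    have h1 : (fun x => mulL2 _ r (actionIntegral ds da h) x * k x) =ᵐ[ds.prod da]
        fun x => ρ x.1 * (∫ a, h (x.1, a) ∂da) * k x := by
      filter_upwards [coeFn_mulL2_of_ae_eq hr (actionIntegral ds da h), coeFn_actionIntegral h]
        with x h1 h2
      rw [h1, h2]
    have hint : Integrable (fun x => mulL2 _ r (actionIntegral ds da h) x * k x) (ds.prod da) := by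
      simpa [mul_comm] using L2.integrable_inner (𝕜 := ℝ) (mulL2 _ r (actionIntegral ds da h)) k
    rw [Lp_two_inner_eq_integral, integral_congr_ae h1, integral_prod _ (hint.congr h1)]
    simp only [integral_const_mul]
  rw [key, inner_mulL2_comm _ h, real_inner_comm _ h, key]
  exact integral_congr_ae (.of_forall fun s => by ring)

end ActionIntegral

/-! ### Second-order expansion of a softmax distribution -/

section Remainder

lemma abs_exp_sub_one_le_mul_exp (x : ℝ) : |Real.exp x - 1| ≤ |x| * Real.exp |x| := by
  have := Complex.norm_exp_sub_sum_le_norm_mul_exp (x : ℂ) 1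
  simp only [Finset.sum_range_one, pow_zero, Nat.factorial_zero, Nat.cast_one, div_one,
    pow_one, Complex.norm_real] at this
  rwa [← Complex.ofReal_exp, ← Complex.ofReal_one, ← Complex.ofReal_sub, Complex.norm_real] at this

lemma abs_exp_sub_one_sub_le_sq_mul_exp (x : ℝ) :
    |Real.exp x - 1 - x| ≤ x ^ 2 * Real.exp |x| := by
  have := Complex.norm_exp_sub_sum_le_norm_mul_exp (x : ℂ) 2
  simp only [Finset.sum_range_succ, Finset.sum_range_zero, zero_add, pow_zero,
    Nat.factorial_zero, Nat.factorial_one, Nat.cast_one, div_one, pow_one, Complex.norm_real,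
    Real.norm_eq_abs, sq_abs] at this
  rw [← Complex.ofReal_exp, ← Complex.ofReal_one, ← Complex.ofReal_add, ← Complex.ofReal_sub,
    Complex.norm_real, Real.norm_eq_abs, ← sub_sub] at this
  exact this

variable {A : Type*} [MeasurableSpace A] {da : Measure A} [IsFiniteMeasure da]

lemma exp_mul_mem_Icc {β B t : ℝ} (ht : |t| ≤ B) :
    Real.exp (-(|β| * B)) ≤ Real.exp (β * t) ∧ Real.exp (β * t) ≤ Real.exp (|β| * B) := by
  have h : |β * t| ≤ |β| * B := by
    rw [abs_mul]
    gcongr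
  exact ⟨Real.exp_le_exp.2 (abs_le.1 h).1, Real.exp_le_exp.2 (abs_le.1 h).2⟩

lemma integrable_exp_mul {β B : ℝ} {u : A → ℝ} (hu : AEStronglyMeasurable u da)
    (huB : ∀ᵐ a ∂da, |u a| ≤ B) : Integrable (fun a => Real.exp (β * u a)) da := by
  refine Integrable.of_bound (Real.continuous_exp.comp_aestronglyMeasurable (hu.const_mul β))
    (Real.exp (|β| * B)) ?_
  filter_upwards [huB] with a ha
  rw [Real.norm_of_nonneg (Real.exp_pos _).le]
  exact (exp_mul_mem_Icc ha).2

lemma le_integral_exp_mul {β B : ℝ} {u : A → ℝ} (hu : AEStronglyMeasurable u da)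
    (huB : ∀ᵐ a ∂da, |u a| ≤ B) :
    da.real Set.univ * Real.exp (-(|β| * B)) ≤ ∫ a, Real.exp (β * u a) ∂da := by
  have := integral_mono_ae (integrable_const (Real.exp (-(|β| * B))))
    (integrable_exp_mul (β := β) hu huB) (huB.mono fun a ha => (exp_mul_mem_Icc ha).1)
  simpa using this

lemma integral_exp_mul_pos [NeZero da] {β B : ℝ} {u : A → ℝ} (hu : AEStronglyMeasurable u da)
    (huB : ∀ᵐ a ∂da, |u a| ≤ B) : 0 < ∫ a, Real.exp (β * u a) ∂da :=
  (mul_pos measureReal_univ_pos (Real.exp_pos _)).trans_le (le_integral_exp_mul hu huB)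

lemma exp_mul_div_integral_le [NeZero da] {β B : ℝ} {u : A → ℝ} (hu : AEStronglyMeasurable u da)
    (huB : ∀ᵐ a ∂da, |u a| ≤ B) {t : ℝ} (ht : |t| ≤ B) :
    Real.exp (β * t) / ∫ a, Real.exp (β * u a) ∂da ≤
      Real.exp (|β| * B) / (da.real Set.univ * Real.exp (-(|β| * B))) :=
  div_le_div₀ (Real.exp_pos _).le (exp_mul_mem_Icc ht).2
    (mul_pos measureReal_univ_pos (Real.exp_pos _)) (le_integral_exp_mul hu huB)

/-- Second-order expansion of a probability density `q` tilted by `e^{y}`: the remainder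
`q e^y / ∫ q e^y - q - q (y - ∫ q y)` is quadratic in `y`, for bounded `q` and `y`. -/
lemma abs_tilt_remainder_le {q y : A → ℝ} {P b : ℝ} (hq : Integrable q da)
    (hq0 : ∀ᵐ a ∂da, 0 ≤ q a) (hqP : ∀ᵐ a ∂da, q a ≤ P) (hq1 : ∫ a, q a ∂da = 1)
    (hy : AEStronglyMeasurable y da) (hyb : ∀ᵐ a ∂da, |y a| ≤ b)
    {q₀ y₀ : ℝ} (hq₀ : 0 ≤ q₀) (hqP₀ : q₀ ≤ P) (hyb₀ : |y₀| ≤ b) :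
    |q₀ * Real.exp y₀ / (∫ a, q a * Real.exp (y a) ∂da) - q₀ -
        q₀ * (y₀ - ∫ a, q a * y a ∂da)| ≤
      P * Real.exp b * (Real.exp b * P * (1 + da.real Set.univ + P * da.real Set.univ) +
        Real.exp b * (1 + P)) * (y₀ ^ 2 + ∫ a, y a ^ 2 ∂da) := by
  have hP : 0 ≤ P := hq₀.trans hqP₀
  set V := da.real Set.univ
  have hV : 0 ≤ V := measureReal_nonneg
  set E := Real.exp b
  have hE : 0 < E := Real.exp_pos b
  have hyi : Integrable y da := Integrable.of_bound hy b hyb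
  have hy2 : MemLp y 2 da := .of_bound hy b hyb
  have hy2i : Integrable (fun a => y a ^ 2) da := hy2.integrable_sq
  have hexpm : AEStronglyMeasurable (fun a => Real.exp (y a)) da :=
    Real.continuous_exp.comp_aestronglyMeasurable hy
  have hqy : Integrable (fun a => q a * y a) da :=
    hq.mul_bdd (c := b) hy (by simpa using hyb)
  have hqe : Integrable (fun a => q a * Real.exp (y a)) da := by
    refine hq.mul_bdd (c := E) hexpm ?_
    filter_upwards [hyb] with a ha
    rw [Real.norm_of_nonneg (Real.exp_pos _).le]
    exact Real.exp_le_exp.2 (abs_le.1 ha).2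
  set m := ∫ a, q a * Real.exp (y a) ∂da
  set μ := ∫ a, q a * y a ∂da
  set H := ∫ a, |y a| ∂da
  set W := ∫ a, y a ^ 2 ∂da
  have hH0 : 0 ≤ H := integral_nonneg fun a => abs_nonneg _
  have hW0 : 0 ≤ W := integral_nonneg fun a => sq_nonneg _
  have hHW : H ^ 2 ≤ V * W := by
    have := sq_integral_le_measure_mul_integral_sq hy2.abs
    simpa [sq_abs] using this
  have hexp1 : ∀ t, |t| ≤ b → |Real.exp t - 1| ≤ E * |t| := fun t ht =>
    (abs_exp_sub_one_le_mul_exp t).trans (by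
      rw [mul_comm]
      exact mul_le_mul_of_nonneg_right (Real.exp_le_exp.2 ht) (abs_nonneg _))
  have hexp2 : ∀ t, |t| ≤ b → |Real.exp t - 1 - t| ≤ E * t ^ 2 := fun t ht =>
    (abs_exp_sub_one_sub_le_sq_mul_exp t).trans (by
      rw [mul_comm]
      exact mul_le_mul_of_nonneg_right (Real.exp_le_exp.2 ht) (sq_nonneg _))
  have hm : E⁻¹ ≤ m := by
    have h := integral_mono_ae (hq.mul_const E⁻¹) hqe (by
      filter_upwards [hq0, hyb] with a h1 h2
      refine mul_le_mul_of_nonneg_left ?_ h1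
      rw [← Real.exp_neg]
      exact Real.exp_le_exp.2 (abs_le.1 h2).1)
    rwa [integral_mul_const, hq1, one_mul] at h
  have hm0 : 0 < m := (inv_pos.2 hE).trans_le hm
  have hμ : |μ| ≤ P * H := by
    rw [← integral_const_mul]
    refine (abs_integral_le_integral_abs).trans (integral_mono_ae hqy.abs (hyi.abs.const_mul P) ?_)
    filter_upwards [hq0, hqP] with a h1 h2
    rw [abs_mul, abs_of_nonneg h1]
    gcongr
  have hm1 : |m - 1| ≤ P * E * H := by
    have h : m - 1 = ∫ a, q a * (Real.exp (y a) - 1) ∂da := by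
      simp only [mul_sub, mul_one]
      rw [integral_sub hqe hq, hq1]
    rw [h, ← integral_const_mul]
    refine (abs_integral_le_integral_abs).trans (integral_mono_ae ?_ (hyi.abs.const_mul _) ?_)
    · simp only [mul_sub, mul_one]
      exact (hqe.sub hq).abs
    · filter_upwards [hq0, hqP, hyb] with a h1 h2 h3
      rw [abs_mul, abs_of_nonneg h1, mul_assoc]
      exact mul_le_mul h2 (hexp1 _ h3) (abs_nonneg _) hP
  have hm2 : |m - 1 - μ| ≤ P * E * W := by
    have h : m - 1 - μ = ∫ a, q a * (Real.exp (y a) - 1 - y a) ∂da := by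
      simp only [mul_sub, mul_one]
      have e := integral_sub (hqe.sub hq) hqy
      simp only [Pi.sub_apply] at e
      rw [e, integral_sub hqe hq, hq1]
    rw [h, ← integral_const_mul]
    refine (abs_integral_le_integral_abs).trans (integral_mono_ae ?_ (hy2i.const_mul _) ?_)
    · simp only [mul_sub, mul_one]
      exact ((hqe.sub hq).sub hqy).abs
    · filter_upwards [hq0, hqP, hyb] with a h1 h2 h3
      rw [abs_mul, abs_of_nonneg h1, mul_assoc]
      exact mul_le_mul h2 (hexp2 _ h3) (abs_nonneg _) hP
  -- collect the first-order terms of `e^y / m`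
  have hR : q₀ * Real.exp y₀ / m - q₀ - q₀ * (y₀ - μ) = q₀ * m⁻¹ *
      ((y₀ - μ) * -(m - 1) + (Real.exp y₀ - 1 - y₀) + -(m - 1 - μ)) := by
    field_simp
    ring
  have h1 : |(y₀ - μ) * -(m - 1)| ≤ E * P * (1 + V + P * V) * (y₀ ^ 2 + W) := by
    rw [abs_mul, abs_neg]
    have h2 : |y₀ - μ| ≤ |y₀| + P * H := (abs_sub _ _).trans (by linarith)
    have h3 : |y₀| * H ≤ y₀ ^ 2 + V * W := by
      have := sq_nonneg (|y₀| - H)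
      have h4 := sq_abs y₀
      nlinarith [sq_nonneg H, sq_nonneg y₀]
    calc |y₀ - μ| * |m - 1| ≤ (|y₀| + P * H) * (P * E * H) := by gcongr
      _ = E * P * (|y₀| * H + P * H ^ 2) := by ring
      _ ≤ E * P * ((y₀ ^ 2 + V * W) + P * (V * W)) := by gcongr
      _ ≤ E * P * ((1 + V + P * V) * (y₀ ^ 2 + W)) := by
          gcongr
          have e1 : 0 ≤ V * y₀ ^ 2 := by positivity
          have e2 : 0 ≤ P * V * y₀ ^ 2 := by positivity
          nlinarith
      _ = _ := by ring
  have h2 : |Real.exp y₀ - 1 - y₀| + |m - 1 - μ| ≤ E * (1 + P) * (y₀ ^ 2 + W) := by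
    have e0 := hexp2 y₀ hyb₀
    have e1 : 0 ≤ E * W := by positivity
    have e2 : 0 ≤ E * P * y₀ ^ 2 := by positivity
    nlinarith
  rw [hR, abs_mul, abs_of_nonneg (mul_nonneg hq₀ (inv_pos.2 hm0).le)]
  have h3 : |(y₀ - μ) * -(m - 1) + (Real.exp y₀ - 1 - y₀) + -(m - 1 - μ)| ≤
      (E * P * (1 + V + P * V) + E * (1 + P)) * (y₀ ^ 2 + W) := by
    refine (abs_add_three _ _ _).trans ?_
    rw [abs_neg (m - 1 - μ)]
    linarith
  have h4 : m⁻¹ ≤ E := inv_le_of_inv_le₀ hE hm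
  calc _ ≤ (P * E) * ((E * P * (1 + V + P * V) + E * (1 + P)) * (y₀ ^ 2 + W)) := by gcongr
    _ = _ := by ring

end Remainder

/-! ### Softmax policies -/

section Softmax

variable {S A : Type*} [MeasurableSpace S] [MeasurableSpace A] {ds : Measure S} {da : Measure A}
  {β B : ℝ} {f : QSpace ds da}

lemma aestronglyMeasurable_fiber (f : QSpace ds da) (s : S) :
    AEStronglyMeasurable (fun a => f (s, a)) da :=
  ((Lp.stronglyMeasurable f).comp_measurable measurable_prodMk_left).aestronglyMeasurable

variable [IsFiniteMeasure da]

lemma ae_ae_abs_le_of_mem_boundedQ (hf : f ∈ boundedQ ds da B) :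
    ∀ᵐ x ∂(ds.prod da), ∀ᵐ a ∂da, |f (x.1, a)| ≤ B :=
  ae_ae_fst_of_ae_prod hf

lemma aestronglyMeasurable_softmax (β : ℝ) (f : QSpace ds da) :
    AEStronglyMeasurable
      (fun x => Real.exp (β * f x) / ∫ a, Real.exp (β * f (x.1, a)) ∂da) (ds.prod da) := by
  have h : StronglyMeasurable fun x => Real.exp (β * f x) :=
    Real.continuous_exp.comp_stronglyMeasurable ((Lp.stronglyMeasurable f).const_mul β)
  have h' : StronglyMeasurable fun x : S × A => ∫ a, Real.exp (β * f (x.1, a)) ∂da :=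
    (StronglyMeasurable.integral_prod_right (f := fun s a => Real.exp (β * f (s, a))) h
      ).comp_measurable measurable_fst
  exact (h.measurable.div h'.measurable).aestronglyMeasurable

lemma ae_norm_softmax_le [NeZero da] (hf : f ∈ boundedQ ds da B) :
    ∀ᵐ x ∂(ds.prod da), ‖Real.exp (β * f x) / ∫ a, Real.exp (β * f (x.1, a)) ∂da‖ ≤
      Real.exp (|β| * B) / (da.real Set.univ * Real.exp (-(|β| * B))) := by
  filter_upwards [ae_ae_abs_le_of_mem_boundedQ hf, hf] with x h1 h2
  have h := integral_exp_mul_pos (β := β) (aestronglyMeasurable_fiber f x.1) h1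
  rw [Real.norm_of_nonneg (div_nonneg (Real.exp_pos _).le h.le)]
  exact exp_mul_div_integral_le (aestronglyMeasurable_fiber f x.1) h1 h2

variable [IsFiniteMeasure ds]

/-- The derivative `h ↦ β p (h - ∫ p h da)` of the softmax mapping at a Q-function with softmax
policy `p`. -/
noncomputable def softmaxDeriv (β : ℝ) (p : DensitySpace ds da) :
    QSpace ds da →L[ℝ] QSpace ds da :=
  β • (mulL2 _ p).comp
    (ContinuousLinearMap.id ℝ _ - (actionIntegral ds da).comp (mulL2 _ p))

lemma actionIntegral_mulL2_ae_eq {p : DensitySpace ds da} {π : QSpace ds da}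
    (hp : p =ᵐ[ds.prod da] π) (h : QSpace ds da) :
    actionIntegral ds da (mulL2 _ p h) =ᵐ[ds.prod da] fun x => actionMean π h x.1 := by
  filter_upwards [coeFn_actionIntegral (mulL2 _ p h), ae_ae_fst_of_ae_prod (coeFn_mulL2 p h),
    ae_ae_fst_of_ae_prod hp] with x h1 h2 h3
  rw [h1, actionMean]
  refine integral_congr_ae ?_
  filter_upwards [h2, h3] with a h4 h5
  rw [h4, h5]

lemma coeFn_softmaxDeriv {p : DensitySpace ds da} {π : QSpace ds da}
    (hp : p =ᵐ[ds.prod da] π) (h : QSpace ds da) :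
    softmaxDeriv β p h =ᵐ[ds.prod da]
      fun x => β * π x * (h x - actionMean π h x.1) := by
  have e : softmaxDeriv β p h = β • mulL2 _ p (h - actionIntegral ds da (mulL2 _ p h)) := rfl
  rw [e]
  filter_upwards [Lp.coeFn_smul β (mulL2 _ p (h - actionIntegral ds da (mulL2 _ p h))),
    coeFn_mulL2 p (h - actionIntegral ds da (mulL2 _ p h)),
    Lp.coeFn_sub h (actionIntegral ds da (mulL2 _ p h)), actionIntegral_mulL2_ae_eq hp h, hp]
    with x h1 h2 h3 h4 h5
  rw [h1, Pi.smul_apply, h2, h3, Pi.sub_apply, h4, h5, smul_eq_mul, mul_assoc]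

/-- The softmax derivative is symmetric for the visitation-weighted pairings, so that its adjoint
sends `f` to `β` times the advantage of `f`. -/
lemma isVisitAdjoint_softmaxDeriv {ρ : S → ℝ} {r p : DensitySpace ds da}
    (hr : r =ᵐ[ds.prod da] fun x => ρ x.1) {π : QSpace ds da} (hp : p =ᵐ[ds.prod da] π)
    (f : QSpace ds da) :
    IsVisitAdjoint ρ π (softmaxDeriv β p) f (fun x => β * advantage π f x) := by
  have hL : ∀ h, softmaxDeriv β p h =
      β • mulL2 _ p (h - actionIntegral ds da (mulL2 _ p h)) := fun h => rfl
  -- with `u = β A_f`, the product `π u` is the softmax derivative applied to `f` itself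
  have hu : mulL2 _ r (softmaxDeriv β p f) =ᵐ[ds.prod da]
      fun x => ρ x.1 * π x * (β * advantage π f x) := by
    filter_upwards [coeFn_mulL2_of_ae_eq hr (softmaxDeriv β p f), coeFn_softmaxDeriv hp f]
      with x h1 h2
    rw [h1, h2, advantage]
    ring
  refine ⟨(memLp_congr_ae hu).1 (Lp.memLp _), fun h => ?_⟩
  have hl : ∫ x, ρ x.1 * softmaxDeriv β p h x * f x ∂(ds.prod da) =
      inner ℝ (mulL2 _ r (softmaxDeriv β p h)) f := by
    rw [inner_mulL2]
    refine integral_congr_ae ?_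
    filter_upwards [hr] with x hx
    rw [hx]
  have hr' : ∫ x, ρ x.1 * π x * h x * (β * advantage π f x) ∂(ds.prod da) =
      inner ℝ (mulL2 _ r (softmaxDeriv β p f)) h := by
    rw [Lp_two_inner_eq_integral]
    refine integral_congr_ae ?_
    filter_upwards [hu] with x hx
    rw [hx]
    ring
  have hsymm := inner_mulL2_actionIntegral hr (mulL2 _ p h) (mulL2 _ p f)
  have hcomm : ∀ k l : QSpace ds da, inner ℝ (mulL2 _ r (mulL2 _ p k)) l =
      inner ℝ (mulL2 _ r k) (mulL2 _ p l) := fun k l => by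
    rw [mulL2_comm, inner_mulL2_comm]
  have hswap : ∀ k l : QSpace ds da, inner ℝ (mulL2 _ r k) l = inner ℝ (mulL2 _ r l) k :=
    fun k l => by rw [inner_mulL2_comm, real_inner_comm]
  rw [hl, hr', hL, hL, map_smul, map_smul, real_inner_smul_left, real_inner_smul_left, hcomm,
    hcomm, map_sub, map_sub, inner_sub_left, inner_sub_left, hsymm, hswap (mulL2 _ p h),
    ← hcomm, hswap (mulL2 _ p h)]

/-- Two bounds for an `L²` function that is pointwise quadratic in a bounded function: it is
linearly small in `L²` and quadratically small in `L¹`. -/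
lemma norm_le_and_integral_abs_le_of_ae_le {C : ℝ} (hC : 0 ≤ C) {R h : QSpace ds da} {b : ℝ}
    (hb : ∀ᵐ x ∂(ds.prod da), |h x| ≤ b)
    (hR : ∀ᵐ x ∂(ds.prod da), |R x| ≤ C * (h x ^ 2 + ∫ a, h (x.1, a) ^ 2 ∂da)) :
    ‖R‖ ≤ C * (|b| * (1 + da.real Set.univ)) * ‖h‖ ∧
      ∫ x, |R x| ∂(ds.prod da) ≤ C * (1 + da.real Set.univ) * ‖h‖ ^ 2 := by
  set V := da.real Set.univ
  have hV : 0 ≤ V := measureReal_nonneg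
  have hQi : Integrable (fun x : S × A => h x ^ 2 + ∫ a, h (x.1, a) ^ 2 ∂da) (ds.prod da) :=
    (Lp.memLp h).integrable_sq.add (integrable_fiber_integral_sq h)
  have hQ : ∫ x, (h x ^ 2 + ∫ a, h (x.1, a) ^ 2 ∂da) ∂(ds.prod da) = (1 + V) * ‖h‖ ^ 2 := by
    rw [integral_add (Lp.memLp h).integrable_sq (integrable_fiber_integral_sq h),
      integral_fiber_integral_sq, ← real_inner_self_eq_norm_sq, Lp_two_inner_eq_integral]
    simp only [sq]
    ring
  constructor
  · refine le_of_sq_le_sq ?_ (by positivity)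
    have h0 : ‖R‖ ^ 2 = ∫ x, R x ^ 2 ∂(ds.prod da) := by
      rw [← real_inner_self_eq_norm_sq, Lp_two_inner_eq_integral]
      simp only [sq]
    calc ‖R‖ ^ 2 = ∫ x, R x ^ 2 ∂(ds.prod da) := h0
      _ ≤ ∫ x, C ^ 2 * (b ^ 2 * (1 + V)) * (h x ^ 2 + ∫ a, h (x.1, a) ^ 2 ∂da) ∂(ds.prod da) := by
        refine integral_mono_ae (Lp.memLp R).integrable_sq (hQi.const_mul _) ?_
        filter_upwards [hR, hb, ae_ae_fst_of_ae_prod hb,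
          Measure.quasiMeasurePreserving_fst.ae (ae_memLp_two_fiber h)] with x h1 h2 h3 h4
        have h5 : ∫ a, h (x.1, a) ^ 2 ∂da ≤ V * b ^ 2 := by
          have := integral_mono_ae h4.integrable_sq (integrable_const (b ^ 2))
            (h3.mono fun a ha => sq_le_sq' (abs_le.1 ha).1 (abs_le.1 ha).2)
          simpa using this
        have h6 : h x ^ 2 ≤ b ^ 2 := sq_le_sq' (abs_le.1 h2).1 (abs_le.1 h2).2
        have h7 : 0 ≤ h x ^ 2 + ∫ a, h (x.1, a) ^ 2 ∂da :=
          add_nonneg (sq_nonneg _) (integral_nonneg fun a => sq_nonneg _)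
        calc R x ^ 2 = |R x| ^ 2 := (sq_abs _).symm
          _ ≤ (C * (h x ^ 2 + ∫ a, h (x.1, a) ^ 2 ∂da)) ^ 2 := by gcongr
          _ = C ^ 2 * (h x ^ 2 + ∫ a, h (x.1, a) ^ 2 ∂da) *
              (h x ^ 2 + ∫ a, h (x.1, a) ^ 2 ∂da) := by ring
          _ ≤ C ^ 2 * (b ^ 2 * (1 + V)) * (h x ^ 2 + ∫ a, h (x.1, a) ^ 2 ∂da) := by
            gcongr
            linarith
      _ = C ^ 2 * (b ^ 2 * (1 + V)) * ((1 + V) * ‖h‖ ^ 2) := by rw [integral_const_mul, hQ]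
      _ = _ := by
        rw [← sq_abs b]
        ring
  · rw [mul_assoc, ← hQ, ← integral_const_mul]
    exact integral_mono_ae ((Lp.memLp R).integrable one_le_two).abs (hQi.const_mul C) hR

variable [NeZero da]

lemma softmax_ae_eq (hf : f ∈ boundedQ ds da B) :
    softmax β f =ᵐ[ds.prod da]
      fun x => Real.exp (β * f x) / ∫ a, Real.exp (β * f (x.1, a)) ∂da :=
  coeFn_toL2 (.of_bound (aestronglyMeasurable_softmax β f) _ (ae_norm_softmax_le hf))

lemma exists_Lp_top_softmax (hf : f ∈ boundedQ ds da B) :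
    ∃ p : DensitySpace ds da, p =ᵐ[ds.prod da] softmax β f := by
  have hm := memLp_top_of_bound (aestronglyMeasurable_softmax β f) _ (ae_norm_softmax_le hf)
  exact ⟨hm.toLp _, hm.coeFn_toLp.trans (softmax_ae_eq hf).symm⟩

lemma isPolicy_softmax (hf : f ∈ boundedQ ds da B) : IsPolicy ds da (softmax β f) := by
  constructor
  · filter_upwards [softmax_ae_eq (β := β) hf] with x hx
    rw [hx]
    exact div_nonneg (Real.exp_pos _).le (integral_nonneg fun a => (Real.exp_pos _).le)
  · filter_upwards [Measure.ae_ae_of_ae_prod (softmax_ae_eq (β := β) hf),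
      Measure.ae_ae_of_ae_prod hf] with s h1 h2
    rw [integral_congr_ae h1, integral_div]
    exact div_self (integral_exp_mul_pos (aestronglyMeasurable_fiber f s) h2).ne'

/-- The remainder in the first-order expansion of the softmax mapping on uniformly bounded
Q-functions is pointwise quadratic in the increment. -/
lemma exists_ae_abs_softmax_remainder_le (hf : f ∈ boundedQ ds da B) {p : DensitySpace ds da}
    (hp : p =ᵐ[ds.prod da] softmax β f) :
    ∃ C, 0 ≤ C ∧ ∀ f' ∈ boundedQ ds da B, ∀ᵐ x ∂(ds.prod da),
      |(softmax β f' - softmax β f - softmaxDeriv β p (f' - f)) x| ≤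
        C * ((f' - f) x ^ 2 + ∫ a, (f' - f) (x.1, a) ^ 2 ∂da) := by
  set P := Real.exp (|β| * B) / (da.real Set.univ * Real.exp (-(|β| * B)))
  set b := |β| * (B + B)
  set K := P * Real.exp b * (Real.exp b * P * (1 + da.real Set.univ + P * da.real Set.univ) +
        Real.exp b * (1 + P))
  have hP : 0 ≤ P := div_nonneg (Real.exp_pos _).le (mul_nonneg measureReal_nonneg
    (Real.exp_pos _).le)
  have hK : 0 ≤ K := by
    have : 0 ≤ da.real Set.univ := measureReal_nonneg
    positivity
  refine ⟨K * β ^ 2, by positivity, fun f' hf' => ?_⟩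
  filter_upwards [Lp.coeFn_sub (softmax β f' - softmax β f) (softmaxDeriv β p (f' - f)),
    Lp.coeFn_sub (softmax β f') (softmax β f), Lp.coeFn_sub f' f,
    ae_ae_fst_of_ae_prod (Lp.coeFn_sub f' f), coeFn_softmaxDeriv (β := β) hp (f' - f),
    softmax_ae_eq (β := β) hf, softmax_ae_eq (β := β) hf',
    ae_ae_fst_of_ae_prod (softmax_ae_eq (β := β) hf), hf, hf',
    ae_ae_abs_le_of_mem_boundedQ hf, ae_ae_abs_le_of_mem_boundedQ hf']
    with x h1 h2 h3 h4 h5 h6 h7 h8 h9 h10 h11 h12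
  have hm := aestronglyMeasurable_fiber f x.1
  have hm' := aestronglyMeasurable_fiber f' x.1
  set Z := ∫ a, Real.exp (β * f (x.1, a)) ∂da
  set Z' := ∫ a, Real.exp (β * f' (x.1, a)) ∂da
  have hZ : 0 < Z := integral_exp_mul_pos hm h11
  have hZ' : 0 < Z' := integral_exp_mul_pos hm' h12
  have hbound : ∀ {s t : ℝ}, |s| ≤ B → |t| ≤ B → |β * (t - s)| ≤ b := fun hs ht => by
    rw [abs_mul]
    exact mul_le_mul_of_nonneg_left ((abs_sub _ _).trans (add_le_add ht hs)) (abs_nonneg _)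
  have hexp : ∀ s t : ℝ, Real.exp (β * s) / Z * Real.exp (β * (t - s)) = Real.exp (β * t) / Z :=
    fun s t => by
      rw [div_mul_eq_mul_div, ← Real.exp_add]
      ring_nf
  have key := abs_tilt_remainder_le (da := da) (q := fun a => Real.exp (β * f (x.1, a)) / Z)
    (y := fun a => β * (f' (x.1, a) - f (x.1, a))) (P := P) (b := b)
    (q₀ := Real.exp (β * f x) / Z) (y₀ := β * (f' x - f x))
    ((integrable_exp_mul hm h11).div_const Z)
    (.of_forall fun a => div_nonneg (Real.exp_pos _).le hZ.le)
    (h11.mono fun a ha => exp_mul_div_integral_le hm h11 ha)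
    (by rw [integral_div]; exact div_self hZ.ne')
    ((hm'.sub hm).const_mul β)
    (by filter_upwards [h11, h12] with a h h' using hbound h h')
    (div_nonneg (Real.exp_pos _).le hZ.le)
    (exp_mul_div_integral_le hm h11 h9) (hbound h9 h10)
  simp only [hexp] at key
  have e1 : ∫ a, Real.exp (β * f' (x.1, a)) / Z ∂da = Z' / Z := integral_div _ _
  have e2 : ∫ a, Real.exp (β * f (x.1, a)) / Z * (β * (f' (x.1, a) - f (x.1, a))) ∂da =
      β * actionMean (softmax β f) (f' - f) x.1 := by
    rw [actionMean, ← integral_const_mul]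
    refine integral_congr_ae ?_
    filter_upwards [h4, h8] with a ha hb
    rw [ha, hb, Pi.sub_apply]
    ring
  have e3 : ∫ a, (β * (f' (x.1, a) - f (x.1, a))) ^ 2 ∂da =
      β ^ 2 * ∫ a, (f' - f) (x.1, a) ^ 2 ∂da := by
    rw [← integral_const_mul]
    refine integral_congr_ae ?_
    filter_upwards [h4] with a ha
    rw [ha, Pi.sub_apply, mul_pow]
  rw [e1, e2, e3] at key
  rw [h1, Pi.sub_apply, h2, Pi.sub_apply, h5, h6, h7, h3, Pi.sub_apply]
  have e4 : Real.exp (β * f' x) / Z / (Z' / Z) = Real.exp (β * f' x) / Z' := by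
    field_simp
  rw [e4] at key
  calc _ = |Real.exp (β * f' x) / Z' - Real.exp (β * f x) / Z -
        Real.exp (β * f x) / Z *
          (β * (f' x - f x) - β * actionMean (softmax β f) (f' - f) x.1)| := by
        congr 1
        ring
    _ ≤ _ := key
    _ = _ := by ring

/-- The softmax mapping on uniformly bounded Q-functions has `softmaxDeriv` as derivative: its
remainder is `O(‖f' - f‖)` in norm, and `O(‖f' - f‖²)` when tested against a bounded function. -/
lemma hasPolicyDerivWithinAt_softmax (hf : f ∈ boundedQ ds da B) {p : DensitySpace ds da}
    (hp : p =ᵐ[ds.prod da] softmax β f) :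
    HasPolicyDerivWithinAt (softmax β) (softmaxDeriv β p) (boundedQ ds da B) f := by
  obtain ⟨C, hC, hR⟩ := exists_ae_abs_softmax_remainder_le hf hp
  set V := da.real Set.univ
  set R := fun f' => softmax β f' - softmax β f - softmaxDeriv β p (f' - f)
  have hRb : ∀ f' ∈ boundedQ ds da B, ‖R f'‖ ≤ C * (|B + B| * (1 + V)) * ‖f' - f‖ ∧
      ∫ x, |R f' x| ∂(ds.prod da) ≤ C * (1 + V) * ‖f' - f‖ ^ 2 := fun f' hf' => by
    refine norm_le_and_integral_abs_le_of_ae_le hC ?_ (hR f' hf')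
    filter_upwards [hf, hf', Lp.coeFn_sub f' f] with x h1 h2 h3
    rw [h3, Pi.sub_apply]
    exact (abs_sub _ _).trans (add_le_add h2 h1)
  have hsub : Tendsto (fun f' => f' - f) (𝓝[boundedQ ds da B] f) (𝓝 0) :=
    tendsto_sub_nhds_zero_iff.2 nhdsWithin_le_nhds
  constructor
  · have h1 : Tendsto R (𝓝[boundedQ ds da B] f) (𝓝 0) := by
      refine squeeze_zero_norm' (a := fun f' => C * (|B + B| * (1 + V)) * ‖f' - f‖) ?_ ?_
      · filter_upwards [self_mem_nhdsWithin] with f' hf' using (hRb f' hf').1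
      · simpa using hsub.norm.const_mul (C * (|B + B| * (1 + V)))
    have h2 := ((softmaxDeriv β p).continuous.tendsto 0).comp hsub
    have h3 := (h1.add h2).add_const (softmax β f)
    simp only [map_zero, zero_add] at h3
    refine h3.congr fun f' => ?_
    simp only [R, Function.comp]
    abel
  · intro φ
    refine .of_isLittleO ?_
    have key := isLittleO_inner_of_dense (R := R) (l := 𝓝[boundedQ ds da B] f) (x := f)
      (dense_Lp_two_ae_bounded (ds.prod da))
      (by filter_upwards [self_mem_nhdsWithin] with f' hf' using (hRb f' hf').1) ?_ φ
    · refine key.congr_left fun f' => ?_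
      simp only [R, inner_sub_right, ContinuousLinearMap.comp_apply, innerSL_apply_apply]
    · -- against a bounded function, the remainder is quadratically small
      rintro ψ ⟨N, hN⟩
      have hO : (fun f' => inner ℝ ψ (R f')) =O[𝓝[boundedQ ds da B] f]
          fun f' => ‖f' - f‖ * ‖f' - f‖ := by
        refine .of_bound (|N| * (C * (1 + V))) ?_
        filter_upwards [self_mem_nhdsWithin] with f' hf'
        have hi := ((Lp.memLp (R f')).integrable one_le_two).abs
        rw [Lp_two_inner_eq_integral, norm_mul, norm_norm, ← sq, mul_assoc]
        calc ‖∫ x, ψ x * R f' x ∂(ds.prod da)‖ ≤ ∫ x, |N| * |R f' x| ∂(ds.prod da) := by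
              refine norm_integral_le_of_norm_le (hi.const_mul _) ?_
              filter_upwards [hN] with x hx
              rw [norm_mul]
              exact mul_le_mul_of_nonneg_right (hx.trans (le_abs_self N)) (abs_nonneg _)
          _ ≤ _ := by
              rw [integral_const_mul]
              exact mul_le_mul_of_nonneg_left (hRb f' hf').2 (abs_nonneg _)
      refine hO.trans_isLittleO ?_
      have ho : (fun f' => ‖f' - f‖) =o[𝓝[boundedQ ds da B] f] fun _ => (1 : ℝ) := by
        rw [Asymptotics.isLittleO_one_iff]
        simpa using hsub.norm
      have := ho.mul_isBigO (Asymptotics.isBigO_refl (fun f' => ‖f' - f‖) _)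
      simp only [one_mul] at this
      exact this.of_norm_right

end Softmax

/-! ### The hypergradient -/

section Hypergradient

variable {S A : Type*} [MeasurableSpace S] [MeasurableSpace A] {ds : Measure S} {da : Measure A}
  {M : MDP S A} {fk : S × A → ℝ}

lemma neZero_of_isProbDensity {d : DensitySpace ds da} (hd : IsProbDensity ds da d) :
    NeZero da := by
  refine ⟨fun h => ?_⟩
  have h0 : ∀ φ : S × A → ℝ, ∫ x, φ x ∂(ds.prod da) = 0 := fun φ => by
    rw [h, Measure.prod_zero, integral_zero_measure]
  exact zero_ne_one ((h0 d).symm.trans hd.2)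

lemma integral_mul_tdError_bellmanL2 (hfk : HasBellmanTarget M ds da fk) (φ : S × A → ℝ) :
    ∫ x, φ x * tdError M fk (bellmanL2 M ds da fk) x ∂(ds.prod da) = 0 := by
  refine integral_eq_zero_of_ae ?_
  filter_upwards [tdError_bellmanL2_ae_eq_zero hfk] with x hx
  rw [hx, Pi.zero_apply, mul_zero]

lemma hasDerivAt_linearMix (doff don : DensitySpace ds da) (m : ℝ) :
    HasDerivAt (linearMix doff don) (doff - don) m := by
  have h := ((hasDerivAt_id m).smul_const doff).add
    (((hasDerivAt_const m (1 : ℝ)).sub (hasDerivAt_id m)).smul_const don)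
  refine h.congr_deriv ?_
  simp [sub_eq_add_neg]

end Hypergradient

theorem mainTheorem2
    {S A : Type*} [MeasurableSpace S] [MeasurableSpace A]
    (ds : Measure S) (da : Measure A) [IsFiniteMeasure ds] [IsFiniteMeasure da]
    (M : MDP S A) (fk : S × A → ℝ) (hfk : HasBellmanTarget M ds da fk)
    -- time weights of the visitation distribution `d^π`
    (c : ℕ → ℝ) (hc : ∀ t, 0 ≤ c t) (hc1 : HasSum c 1) :
    -- (I) general mixing strategies and general differentiable policy mappings
    (∀ {G : Type*} [NormedAddCommGroup G] [NormedSpace ℝ G] (𝒢 : Set G)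
      (dSample : G → DensitySpace ds da) (_ : ∀ g ∈ 𝒢, IsProbDensity ds da (dSample g))
      (g₀ : G) (_ : g₀ ∈ 𝒢)
      (dSample' : G →L[ℝ] DensitySpace ds da) (_ : HasFDerivWithinAt dSample dSample' 𝒢 g₀)
      (_ : ∃ ε > 0, ∀ᵐ x ∂(ds.prod da), ε ≤ dSample g₀ x)
      (𝒟 : Set (QSpace ds da)) (Ψ : QSpace ds da → QSpace ds da)
      (DΨ : QSpace ds da → QSpace ds da →L[ℝ] QSpace ds da)
      (_ : ∀ f ∈ 𝒟, IsPolicy ds da (Ψ f))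
      (_ : ∀ f ∈ 𝒟, HasBoundedVisitDensity M c (Ψ f))
      (_ : ∀ f ∈ 𝒟, HasPolicyDerivWithinAt Ψ (DΨ f) 𝒟 f)
      (fstar : G → QSpace ds da)
      (_ : ∀ g ∈ 𝒢, IsMinOn (Jin M fk (dSample g)) Set.univ (fstar g))
      (_ : fstar g₀ ∈ 𝒟),
      -- the inner problem is well posed near `g₀`
      (∀ᶠ g in 𝓝[𝒢] g₀, ∃! f, IsMinOn (Jin M fk (dSample g)) Set.univ f) ∧
      -- `∇_f J_in = 2 d_g δ_f`
      (∀ g ∈ 𝒢, ∀ f, DifferentiableAt ℝ (Jin M fk (dSample g)) f ∧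
        gradJin M fk (dSample g) f =ᵐ[ds.prod da]
          fun x => 2 * dSample g x * tdError M fk f x) ∧
      -- `H = D²_f J_in(g₀, ·)` and `X f = D²_{gf} J_in(g₀, f)`
      ∃ (H : QSpace ds da ≃L[ℝ] QSpace ds da) (X : QSpace ds da → G →L[ℝ] QSpace ds da),
        (∀ f, HasFDerivAt (gradJin M fk (dSample g₀))
          (H : QSpace ds da →L[ℝ] QSpace ds da) f) ∧
        (∀ h, H h =ᵐ[ds.prod da] fun x => 2 * dSample g₀ x * h x) ∧
        (∀ f, HasFDerivWithinAt (fun g => gradJin M fk (dSample g) f) (X f) 𝒢 g₀) ∧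
        (∀ f v, X f v =ᵐ[ds.prod da] fun x => 2 * dSample' v x * tdError M fk f x) ∧
        -- implicit differentiation of the inner solution
        HasFDerivWithinAt fstar
          (-((H.symm : QSpace ds da →L[ℝ] QSpace ds da).comp (X (fstar g₀)))) 𝒢 g₀ ∧
        -- the gradient of the outer objective in `f`, and the hypergradient at an arbitrary `f`
        (∀ f ∈ 𝒟,
          HasFDerivWithinAt (fun f' => stateValue (visitDensity M c (Ψ f)) (Ψ f') f')
            (innerSL ℝ (gradJout (visitDensity M c (Ψ f)) (Ψ f) (DΨ f) f)) 𝒟 f ∧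
          (c = Pi.single 0 1 → HasFDerivWithinAt (fun f' => Jout M c (Ψ f') f')
            (innerSL ℝ (gradJout (visitDensity M c (Ψ f)) (Ψ f) (DΨ f) f)) 𝒟 f) ∧
          (∀ u, IsVisitAdjoint (visitDensity M c (Ψ f)) (Ψ f) (DΨ f) f u →
            weight (visitDensity M c (Ψ f)) (Ψ f) (DΨ f) f (dSample g₀) =ᵐ[ds.prod da]
              fun x => visitDensity M c (Ψ f) x.1 * Ψ f x * (1 + u x) / dSample g₀ x) ∧
          ∀ v : G,
            -inner ℝ (gradJout (visitDensity M c (Ψ f)) (Ψ f) (DΨ f) f) (H.symm (X f v)) =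
              -(1 / 2) * ∫ x, weight (visitDensity M c (Ψ f)) (Ψ f) (DΨ f) f (dSample g₀) x *
                X f v x ∂(ds.prod da) ∧
            -inner ℝ (gradJout (visitDensity M c (Ψ f)) (Ψ f) (DΨ f) f) (H.symm (X f v)) =
              -∫ x, weight (visitDensity M c (Ψ f)) (Ψ f) (DΨ f) f (dSample g₀) x *
                dSample' v x * tdError M fk f x ∂(ds.prod da)) ∧
        -- the outer-level gradient
        ∃ D : G →L[ℝ] ℝ,
          HasFDerivWithinAt (fun g => Jout M c (Ψ (fstar g)) (fstar g)) D 𝒢 g₀ ∧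
          ∀ v : G,
            D v = -inner ℝ (gradJout (visitDensity M c (Ψ (fstar g₀))) (Ψ (fstar g₀))
                (DΨ (fstar g₀)) (fstar g₀)) (H.symm (X (fstar g₀) v)) ∧
            D v = -∫ x, weight (visitDensity M c (Ψ (fstar g₀))) (Ψ (fstar g₀))
                (DΨ (fstar g₀)) (fstar g₀) (dSample g₀) x * X (fstar g₀) v x ∂(ds.prod da) ∧
            D v = -∫ x, weight (visitDensity M c (Ψ (fstar g₀))) (Ψ (fstar g₀))
                (DΨ (fstar g₀)) (fstar g₀) (dSample g₀) x *
                dSample' v x * tdError M fk (fstar g₀) x ∂(ds.prod da)) ∧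
    -- (II) linear mixing and softmax policies
    (∀ (doff don : DensitySpace ds da)
      (_ : IsProbDensity ds da doff) (_ : IsProbDensity ds da don)
      (m : ℝ) (_ : m ∈ Set.Icc (0 : ℝ) 1)
      (_ : ∃ ε > 0, ∀ᵐ x ∂(ds.prod da), ε ≤ linearMix doff don m x)
      (β B : ℝ) (_ : ∀ᵐ x ∂(ds.prod da), |bellman M fk x| ≤ B)
      (_ : ∀ f ∈ boundedQ ds da B, HasBoundedVisitDensity M c (softmax β f))
      (fstar : ℝ → QSpace ds da)
      (_ : ∀ t ∈ Set.Icc (0 : ℝ) 1, IsMinOn (Jin M fk (linearMix doff don t)) Set.univ (fstar t)),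
      fstar m ∈ boundedQ ds da B ∧
      (∃ L : QSpace ds da → QSpace ds da →L[ℝ] QSpace ds da, ∀ f ∈ boundedQ ds da B,
        IsPolicy ds da (softmax β f) ∧
        (softmax β f =ᵐ[ds.prod da]
          fun x => Real.exp (β * f x) / ∫ a, Real.exp (β * f (x.1, a)) ∂da) ∧
        -- `D_f π [h] = β π (h - E_π h)`
        (∀ h, L f h =ᵐ[ds.prod da]
          fun x => β * softmax β f x * (h x - actionMean (softmax β f) h x.1)) ∧
        HasPolicyDerivWithinAt (softmax β) (L f) (boundedQ ds da B) f ∧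
        -- `(D_f π)† [f] = β A_f`, so that `w = d^π(s) π'(a|s) / d_m`
        IsVisitAdjoint (visitDensity M c (softmax β f)) (softmax β f) (L f) f
          (fun x => β * advantage (softmax β f) f x) ∧
        (weight (visitDensity M c (softmax β f)) (softmax β f) (L f) f (linearMix doff don m)
          =ᵐ[ds.prod da] fun x =>
            visitDensity M c (softmax β f) x.1 * tiltedPolicy β f x / linearMix doff don m x) ∧
        -- the hypergradient at an arbitrary bounded `f`
        -inner ℝ (gradJout (visitDensity M c (softmax β f)) (softmax β f) (L f) f)
            ((fderiv ℝ (gradJin M fk (linearMix doff don m)) f).inverse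
              (derivWithin (fun t => gradJin M fk (linearMix doff don t) f)
                (Set.Icc 0 1) m)) =
          -∫ x, visitDensity M c (softmax β f) x.1 * tiltedPolicy β f x /
            linearMix doff don m x * (doff x - don x) * tdError M fk f x ∂(ds.prod da)) ∧
      -- the outer-level gradient, with `∂_m d_m = d^off - d^on`
      HasDerivWithinAt (fun t => Jout M c (softmax β (fstar t)) (fstar t))
        (-∫ x, visitDensity M c (softmax β (fstar m)) x.1 * tiltedPolicy β (fstar m) x /
          linearMix doff don m x * (doff x - don x) * tdError M fk (fstar m) x ∂(ds.prod da))
        (Set.Icc 0 1) m ∧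
      -- and with the opposite orientation of the difference of the two densities
      HasDerivWithinAt (fun t => Jout M c (softmax β (fstar t)) (fstar t))
        (-∫ x, visitDensity M c (softmax β (fstar m)) x.1 * tiltedPolicy β (fstar m) x /
          linearMix doff don m x * (don x - doff x) * tdError M fk (fstar m) x ∂(ds.prod da))
        (Set.Icc 0 1) m) := by
  set τ := bellmanL2 M ds da fk
  constructor
  · intro G _ _ 𝒢 dSample hprob g₀ hg₀ dSample' hdS hε 𝒟 Ψ DΨ _ hvis hΨ fstar hmin _
    have hev : ∀ᶠ g in 𝓝[𝒢] g₀, fstar g = τ :=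
      eventually_eq_bellmanL2_of_isMinOn hfk hdS.continuousWithinAt hε hmin
    have hg₀τ : fstar g₀ = τ := hev.self_of_nhdsWithin hg₀
    obtain ⟨H, hHL, hH, hHs⟩ := exists_two_mulL2_equiv (dSample g₀) hε
    set X : QSpace ds da → G →L[ℝ] QSpace ds da :=
      fun f => (2 : ℝ) • ((mulL2 _).flip (f - τ)).comp dSample'
    have hX : ∀ f v, X f v =ᵐ[ds.prod da] fun x => 2 * dSample' v x * tdError M fk f x :=
      fun f v => coeFn_two_mulL2_sub_bellmanL2 hfk (dSample' v) f
    -- the mixed second derivative vanishes at the unconstrained optimum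
    have hXτ : X (fstar g₀) = 0 := by
      simp only [X]
      rw [hg₀τ, sub_self, map_zero, ContinuousLinearMap.zero_comp, smul_zero]
    refine ⟨?_, fun g _ f => ⟨(hasFDerivAt_Jin hfk _ f).differentiableAt, ?_⟩, H, X, ?_, hH,
      hasFDerivWithinAt_gradJin hfk hdS, hX, ?_, ?_, 0, ?_, ?_⟩
    · filter_upwards [eventually_exists_pos_le hε hdS.continuousWithinAt, self_mem_nhdsWithin]
        with g hg hg'
      exact ⟨τ, isMinOn_Jin_bellmanL2 hfk (hprob g hg').1,
        fun f hf => eq_bellmanL2_of_isMinOn_Jin hfk hg hf⟩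
    · rw [gradJin_eq hfk]
      exact coeFn_two_mulL2_sub_bellmanL2 hfk _ f
    · intro f
      rw [hHL]
      exact hasFDerivAt_gradJin hfk _ f
    · rw [hXτ, ContinuousLinearMap.comp_zero, neg_zero]
      exact (hasFDerivWithinAt_const τ g₀ 𝒢).congr_of_eventuallyEq hev hg₀τ
    · intro f hf
      obtain ⟨r, hr⟩ := exists_Lp_top_visitDensity (hvis f hf)
      refine ⟨hasFDerivWithinAt_stateValue hr (hΨ f hf), ?_,
        fun u hu => weight_ae_eq_of_isVisitAdjoint hr hu _, fun v => ⟨?_, ?_⟩⟩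
      · intro hc0
        have hb := hvis f hf
        rw [hc0] at hb ⊢
        exact hasFDerivWithinAt_Jout_single_zero (hΨ f hf) hb
      · rw [inner_gradJout_eq_integral_weight (hHs (X f v)), neg_mul]
      · rw [inner_gradJout_eq_integral_weight_tdError (hHs (X f v)) (hX f v)]
    · refine (hasFDerivWithinAt_const (Jout M c (Ψ τ) τ) g₀ 𝒢).congr_of_eventuallyEq ?_ ?_
      · filter_upwards [hev] with g hg
        rw [hg]
      · rw [hg₀τ]
    · intro v
      refine ⟨?_, ?_, ?_⟩
      · simp [hXτ]
      · have h0 : (X (fstar g₀) v : S × A → ℝ) =ᵐ[ds.prod da] 0 := by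
          rw [hXτ]
          exact Lp.coeFn_zero ℝ 2 (ds.prod da)
        rw [zero_apply, eq_comm, neg_eq_zero]
        refine integral_eq_zero_of_ae ?_
        filter_upwards [h0] with x hx
        rw [hx, Pi.zero_apply, mul_zero]
      · rw [hg₀τ, integral_mul_tdError_bellmanL2 hfk, neg_zero, zero_apply]
  · intro doff don hoff hon m hm hε β B hB hvis fstar hmin
    have : NeZero da := neZero_of_isProbDensity hoff
    have hmix : ∀ s, HasDerivWithinAt (linearMix doff don) (doff - don) s m := fun s =>
      (hasDerivAt_linearMix doff don m).hasDerivWithinAt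
    have hev : ∀ᶠ t in 𝓝[Set.Icc 0 1] m, fstar t = τ :=
      eventually_eq_bellmanL2_of_isMinOn hfk (hmix _).continuousWithinAt hε hmin
    have hmτ : fstar m = τ := hev.self_of_nhdsWithin hm
    have hJ : HasDerivWithinAt (fun t => Jout M c (softmax β (fstar t)) (fstar t)) 0
        (Set.Icc 0 1) m := by
      refine (hasDerivWithinAt_const m (Set.Icc 0 1)
        (Jout M c (softmax β τ) τ)).congr_of_eventuallyEq ?_ ?_
      · filter_upwards [hev] with t ht
        rw [ht]
      · rw [hmτ]
    refine ⟨?_, ?_, ?_, ?_⟩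
    · rw [hmτ]
      filter_upwards [coeFn_bellmanL2 hfk, hB] with x h1 h2
      rwa [h1]
    · -- outside `boundedQ` the derivative is irrelevant, and `p f = 0` is taken there
      have hp : ∀ f, ∃ p : DensitySpace ds da,
          f ∈ boundedQ ds da B → p =ᵐ[ds.prod da] softmax β f := fun f => by
        by_cases hf : f ∈ boundedQ ds da B
        · obtain ⟨p, hp⟩ := exists_Lp_top_softmax (β := β) hf
          exact ⟨p, fun _ => hp⟩
        · exact ⟨0, fun h => absurd h hf⟩
      choose p hp using hp
      refine ⟨fun f => softmaxDeriv β (p f), fun f hf => ?_⟩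
      obtain ⟨r, hr⟩ := exists_Lp_top_visitDensity (hvis f hf)
      obtain ⟨H, hHL, -, hHs⟩ := exists_two_mulL2_equiv (linearMix doff don m) hε
      have hadj := isVisitAdjoint_softmaxDeriv (β := β) hr (hp f hf) f
      have hw : weight (visitDensity M c (softmax β f)) (softmax β f) (softmaxDeriv β (p f)) f
          (linearMix doff don m) =ᵐ[ds.prod da] fun x =>
            visitDensity M c (softmax β f) x.1 * tiltedPolicy β f x / linearMix doff don m x := by
        filter_upwards [weight_ae_eq_of_isVisitAdjoint hr hadj (linearMix doff don m)] with x hx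
        rw [hx, tiltedPolicy, mul_assoc]
      refine ⟨isPolicy_softmax hf, softmax_ae_eq hf, coeFn_softmaxDeriv (hp f hf),
        hasPolicyDerivWithinAt_softmax hf (hp f hf), hadj, hw, ?_⟩
      have hinv : (fderiv ℝ (gradJin M fk (linearMix doff don m)) f).inverse =
          (H.symm : QSpace ds da →L[ℝ] QSpace ds da) := by
        rw [(hasFDerivAt_gradJin hfk (linearMix doff don m) f).fderiv, ← hHL,
          ContinuousLinearMap.inverse_equiv]
      have hder : derivWithin (fun t => gradJin M fk (linearMix doff don t) f)
          (Set.Icc 0 1) m = (2 : ℝ) • mulL2 _ (doff - don) (f - τ) := by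
        have h := (hasFDerivWithinAt_gradJin hfk (hmix (Set.Icc 0 1)).hasFDerivWithinAt
          f).hasDerivWithinAt.derivWithin (uniqueDiffOn_Icc_zero_one m hm)
        rw [h]
        simp [τ]
        abel
      rw [hinv, hder, ContinuousLinearEquiv.coe_coe,
        inner_gradJout_eq_integral_weight_tdError (hHs _)
          (coeFn_two_mulL2_sub_bellmanL2 hfk (doff - don) f)]
      refine congrArg _ (integral_congr_ae ?_)
      filter_upwards [hw, Lp.coeFn_sub doff don] with x h1 h2
      rw [h1, h2, Pi.sub_apply]
    · rw [hmτ, integral_mul_tdError_bellmanL2 hfk, neg_zero]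
      exact hJ
    · rw [hmτ, integral_mul_tdError_bellmanL2 hfk, neg_zero]
      exact hJ
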